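/- **Setting.** Let $\mathcal X\subseteq\mathbb R^d$, let $\mathcal Y$ be a measurable space, let $\rho$ be a probability measure on $\mathcal Z=\mathcal X\times\mathcal Y$, and let $S=(z_1,\dots,z_n)$ ($n\ge 1$) be drawn independently from $\rho$. Let $H_K$ be the reproducing kernel Hilbert space of a continuous (Mercer) kernel $K$ on $\mathcal X$, with feature map $\phi(x)=K(\cdot,x)$ satisfying $\sup_{x}\|\phi(x)\|_2\le\kappa$. Let $c\ge 1$, $\mathcal W=H_K^c$ with $\langle \mathbf w,\mathbf v\rangle=\sum_j\langle \mathbf w_j,\mathbf v_j\rangle$, and $h^{\mathbf w}(x)=(\langle \mathbf w_1,\phi(x)\rangle,\dots,\langle \mathbf w_c,\phi(x)\rangle)$. Let $\ell:\mathcal W\times\mathcal Z\to\mathbb R_+$ be a loss, with $\ell(\mathbf w;\cdot)$ measurable and $\rho$-integrable for every $\mathbf w$, and let $r:\mathcal W\to\mathbb R_+$ be a regularizer. Put $$F_S(\mathbf w)=\frac1n\sum_{i=1}^n\ell(\mathbf w;z_i)+r(\mathbf w),\qquad F(\mathbf w)=\mathbb E_{Z\sim\rho}[\ell(\mathbf w;Z)]+r(\mathbf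 w),$$ and let $\mathbf w^*$ be a minimizer of $F$ over $\mathcal W$. **Assumptions.** (i) For some $L>0$, $|\ell(\mathbf w;z)-\ell(\mathbf w';z)|\le L\|h^{\mathbf w}(x)-h^{\mathbf w'}(x)\|_\infty$ for all $\mathbf w,\mathbf w'\in\mathcal W$ and $z=(x,y)\in\mathcal Z$. (ii) $\ell$ is convex in its first argument, and $r$ is $\sigma$-strongly convex ($\sigma>0$) with respect to a norm $\|\cdot\|$ on $\mathcal W$, i.e. for every $\mathbf w'$ there is a subgradient $r'(\mathbf w')\in\mathcal W$ with $r(\mathbf w)\ge r(\mathbf w')+\langle \mathbf w-\mathbf w',r'(\mathbf w')\rangle+\frac\sigma2\|\mathbf w-\mathbf w'\|^2$ for all $\mathbf w$. (iii) $\|\mathbf w\|\ge\max_j\|\mathbf w_j\|_2$ for all $\mathbf w\in\mathcal W$. Let $\|\cdot\|_*$ be the dual norm of $\|\cdot\|$, and let $\widetilde B=\sup_{x\in\mathcal X,\,j\le c}\|\widetilde\phi_j(x)\|_*$, where $\widetilde\phi_j(x)=(0,\dots,0,\phi(x),0,\dots,0)\in\mathcal W$ has $\phi(x)$ in position $j$.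 **Theorem.** There are an absolute integer $p\ge 0$ and a constant $C>0$ depending only on $L$ and $\kappa$ such that, in every such setting and for every $\delta\in(0,1)$, the following two statements hold. Write $\Delta(\mathbf w)=F(\mathbf w)-F(\mathbf w^*)$. 1. With probability at least $1-\delta$, simultaneously for all $\mathbf w\in\mathcal W$, $$\Delta(\mathbf w)\le\max\Big\{F_S(\mathbf w)-F_S(\mathbf w^*),\frac1{n\sigma}\Big\}+C\Big(1+\log(nc)+\log\max\{1,n\sigma\Delta(\mathbf w)\}\Big)^{p}\sqrt{\frac{\Delta(\mathbf w)\,\big(\log(1/\delta)+\widetilde B\big)}{n\sigma}} .$$ 2. With probability at least $1-\delta$, every minimizer $\mathbf w_S$ of $F_S$ over $\mathcal W$ satisfies $$F(\mathbf w_S)-F(\mathbf w^*)\le C\,\big(1+\log(nc)\big)^{p}\,\frac{\log(1/\delta)+\widetilde B}{n\sigma}.$$ -/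

import Mathlib

open MeasureTheory

noncomputable section

namespace VectorValuedLearning

/-- An event `P` holds with probability at least `1 - δ` under `μ`: it contains a measurable event
of probability at least `1 - δ`. -/
def HoldsWithProb {Ω : Type*} [MeasurableSpace Ω] (μ : Measure Ω) (δ : ℝ) (P : Ω → Prop) : Prop :=
  ∃ G : Set Ω, MeasurableSet G ∧ ENNReal.ofReal (1 - δ) ≤ μ G ∧ ∀ S ∈ G, P S

section HypothesisSpace

variable {H : Type*} [NormedAddCommGroup H] [InnerProductSpace ℝ H] {c : ℕ}

/-- The inner product `⟨w, v⟩ = ∑ⱼ ⟨wⱼ, vⱼ⟩` of the hypothesis space `W = H ^ c`. -/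
def innerProd (w v : Fin c → H) : ℝ := ∑ j, inner ℝ (w j) (v j)

/-- The dual norm `‖v‖_* = sup {⟨w, v⟩ : ‖w‖ ≤ 1}` of the norm `N` on `W = H ^ c`. -/
def dualNorm (N : Seminorm ℝ (Fin c → H)) (v : Fin c → H) : ℝ :=
  sSup {t : ℝ | ∃ w : Fin c → H, N w ≤ 1 ∧ t = innerProd w v}

/-- `r` is `σ`-strongly convex with respect to `N`: at every point `w'` there is a (sub)gradient
`g = r'(w')` for which the quadratic lower bound holds. -/
def IsStronglyConvex (N : Seminorm ℝ (Fin c → H)) (σ : ℝ) (r : (Fin c → H) → ℝ) : Prop :=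
  ∀ w' : Fin c → H, ∃ g : Fin c → H, ∀ w : Fin c → H,
    r w' + innerProd (w - w') g + σ / 2 * N (w - w') ^ 2 ≤ r w

/-- `‖w‖ ≥ ‖w‖_{2,∞} = maxⱼ ‖wⱼ‖₂` for all `w`; in particular the seminorm `N` is a norm. -/
def DominatesTwoInfty (N : Seminorm ℝ (Fin c → H)) : Prop :=
  ∀ (w : Fin c → H) (j : Fin c), ‖w j‖ ≤ N w

end HypothesisSpace

section Predictor

variable {X : Type*} (H : Type*) [NormedAddCommGroup H] [InnerProductSpace ℝ H] [CompleteSpace H]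
  [RKHS ℝ H X ℝ]

/-- The canonical feature map `φ(x) = K(·, x)` of the reproducing kernel Hilbert space `H`. -/
def featureMap (x : X) : H := RKHS.kerFun H x (1 : ℝ)

/-- The real-valued reproducing kernel `K(x, x') = ⟨φ(x), φ(x')⟩` of `H`. -/
def kernelFun (x x' : X) : ℝ := inner ℝ (featureMap H x) (featureMap H x')

variable {H} {c : ℕ}

/-- The vector-valued predictor `h^w(x) = (⟨w₁, φ(x)⟩, …, ⟨w_c, φ(x)⟩)`. Its norm in `Fin c → ℝ`
is the `ℓ_∞` norm. -/
def predictor (w : Fin c → H) (x : X) : Fin c → ℝ := fun j => inner ℝ (w j) (featureMap H x)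

variable (H) in
/-- `φ̃ⱼ(x) = (0, …, 0, φ(x), 0, …, 0)`, with `φ(x)` at position `j`. -/
def featureAt (j : Fin c) (x : X) : Fin c → H := Pi.single j (featureMap H x)

/-- `B̃ = sup_{(x, j)} ‖φ̃ⱼ(x)‖_*`. -/
def Btilde (N : Seminorm ℝ (Fin c → H)) : ℝ :=
  ⨆ p : X × Fin c, dualNorm N (featureAt H p.2 p.1)

/-- Lipschitz continuity of the loss with respect to the infinity norm of the predictions. -/
def IsLipschitzLoss {Y : Type*} (L : ℝ) (loss : (Fin c → H) → X × Y → ℝ) : Prop :=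
  ∀ (w w' : Fin c → H) (z : X × Y),
    |loss w z - loss w' z| ≤ L * ‖predictor w z.1 - predictor w' z.1‖

end Predictor

section Risk

variable {W Z : Type*}

/-- The regularized empirical risk `F_S(w) = (1/n) ∑ᵢ ℓ(w; zᵢ) + r(w)`. -/
def empiricalRisk {n : ℕ} (loss : W → Z → ℝ) (r : W → ℝ) (S : Fin n → Z) (w : W) : ℝ :=
  (1 / (n : ℝ)) * ∑ i, loss w (S i) + r w

/-- The regularized risk `F(w) = E_Z[ℓ(w; Z)] + r(w)`. -/
def regularizedRisk [MeasurableSpace Z] (ρ : Measure Z) (loss : W → Z → ℝ) (r : W → ℝ) (w : W) :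
    ℝ :=
  ∫ z, loss w z ∂ρ + r w

end Risk

end VectorValuedLearning

end

/-! Both bounds follow from a one-sided uniform deviation inequality on the sublevel set `{Δ ≤ Λ}`
of the excess risk: up to logarithms, `Δ(w) - (F_S(w) - F_S(w*))` is at most `L B̃ (1 + √log(1/δ))
√(Λ/(nσ))` there. The regularizer cancels from this difference; it matters only through the geometry
of the sublevel set.

The delicate point is a metric entropy bound with only logarithmic dependence on `c`. The excess
risk `D` is strongly convex, so its convex conjugate is smooth. For a fixed `u` in the sublevel set
and finitely many functionals `ψₖ`, greedy coordinate descent on `a ↦ D*(∑ aₖψₖ) - ∑ aₖψₖ(u)` must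
soon reach an `a` whose approximate maximizer agrees with `u` to within `ε` on every `ψₖ`, because
this function starts at most `0` and never drops below `-Λ`. Counting the descent paths bounds the
cover (`exists_finset_cover_aux`). Applied to the `2nc` predictions on a sample of pairs, and
transferred to the loss by its `ℓ_∞`-Lipschitz property, this gives log-cardinality of order `4^k
log(nc)` at relative scale `2^{-k}`.

Such entropy is critical for chaining: each dyadic scale costs the same, and about `log n` scales
are needed (`exists_finset_sign_sum_le`). A ghost sample and random swaps reduce the true deviation
to these signed sums (`measure_exists_deviation_lt_le`), and separability of `H` reduces the class
to a countable one.

The uniform bound then follows by peeling over dyadic values of `Δ` (`exists_event_uniform`). For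
empirical minimizers a single level `Λ` suffices: by convexity, a minimizer outside the sublevel set
would yield a violation on its boundary (`exists_event_minimizer_le`). -/

noncomputable section

namespace VectorValuedLearning

/-! ### Covering sublevel sets of strongly convex functions by duality. -/

section Covering

variable {E ι : Type*} [AddCommGroup E] [Module ℝ E]

/-- Midpoint form of `σ`-strong convexity with respect to a seminorm. -/
def MidpointStronglyConvex (N : Seminorm ℝ E) (σ : ℝ) (D : E → ℝ) : Prop :=
  ∀ w w' : E, D ((1 / 2 : ℝ) • (w + w')) + σ / 8 * N (w - w') ^ 2 ≤ (D w + D w') / 2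

lemma MidpointStronglyConvex.sq_le {N : Seminorm ℝ E} {σ : ℝ} {D : E → ℝ}
    (hD : MidpointStronglyConvex N σ D) (hσ : 0 < σ) (h0 : ∀ w, 0 ≤ D w) {w₀ : E}
    (hw₀ : D w₀ = 0) (w : E) : N (w - w₀) ^ 2 ≤ 4 * D w / σ := by
  have h1 := hD w w₀
  have h2 := h0 ((1 / 2 : ℝ) • (w + w₀))
  rw [le_div_iff₀ hσ]
  linarith

lemma MidpointStronglyConvex.le_of_le {N : Seminorm ℝ E} {σ : ℝ} {D : E → ℝ}
    (hD : MidpointStronglyConvex N σ D) (hσ : 0 < σ) (h0 : ∀ w, 0 ≤ D w) {w₀ : E}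
    (hw₀ : D w₀ = 0) {w : E} {Λ : ℝ} (hw : D w ≤ Λ) : N (w - w₀) ≤ 2 * √(Λ / σ) := by
  have h1 := hD.sq_le hσ h0 hw₀ w
  have h2 : N (w - w₀) ≤ √(4 * (Λ / σ)) := by
    apply Real.le_sqrt_of_sq_le
    refine h1.trans ?_
    rw [mul_div_assoc]
    gcongr
  rwa [Real.sqrt_mul (by norm_num), show (4 : ℝ) = 2 ^ 2 by norm_num,
    Real.sqrt_sq (by norm_num)] at h2

variable [Fintype ι]

/-- The convex conjugate of `D` at the functional `∑ₖ aₖ ψₖ`. -/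
def conjugate (D : E → ℝ) (ψ : ι → E →ₗ[ℝ] ℝ) (a : ι → ℝ) : ℝ :=
  ⨆ w : E, ((∑ k, a k * ψ k w) - D w)

variable {N : Seminorm ℝ E} {σ B : ℝ} {D : E → ℝ} {ψ : ι → E →ₗ[ℝ] ℝ} {w₀ : E}

/-- Linear growth in `N (w - w₀)` loses to the quadratic growth of `D`, so the supremum in
`conjugate` is genuine rather than a default value. -/
lemma bddAbove_conjugate (hD : MidpointStronglyConvex N σ D) (hσ : 0 < σ) (h0 : ∀ w, 0 ≤ D w)
    (hw₀ : D w₀ = 0) (hψ : ∀ k w, |ψ k w| ≤ B * N w) (a : ι → ℝ) :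
    BddAbove (Set.range fun w : E => (∑ k, a k * ψ k w) - D w) := by
  set A : ℝ := ∑ k, |a k| * B with hA
  refine ⟨(∑ k, a k * ψ k w₀) + A ^ 2 / σ, ?_⟩
  rintro _ ⟨w, rfl⟩
  have h1 : (∑ k, a k * ψ k w) - (∑ k, a k * ψ k w₀) ≤ A * N (w - w₀) := by
    rw [← Finset.sum_sub_distrib, hA, Finset.sum_mul]
    refine Finset.sum_le_sum fun k _ => ?_
    rw [← mul_sub, ← map_sub, mul_assoc]
    refine (le_abs_self _).trans ?_
    rw [abs_mul]
    exact mul_le_mul_of_nonneg_left (hψ k _) (abs_nonneg _)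
  have h2 := hD.sq_le hσ h0 hw₀ w
  rw [le_div_iff₀ hσ] at h2
  have h3 : A * N (w - w₀) ≤ A ^ 2 / σ + N (w - w₀) ^ 2 * σ / 4 := by
    have : A ^ 2 / σ * σ = A ^ 2 := div_mul_cancel₀ _ hσ.ne'
    have h4 : 0 ≤ (A / σ - N (w - w₀) / 2) ^ 2 * σ := by positivity
    have h5 : (A / σ - N (w - w₀) / 2) ^ 2 * σ
        = A ^ 2 / σ + N (w - w₀) ^ 2 * σ / 4 - A * N (w - w₀) := by
      field_simp; ring
    linarith
  dsimp only
  linarith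

/-- Smoothness of the conjugate, with the values `ψ k v` at a `τ`-approximate maximizer in the role
of its gradient; the supremum need not be attained. Testing the supremum at the midpoint of `v` and
`w` gains `σ/4 * N (v - w) ^ 2`, which absorbs the linear perturbation by completing the square. -/
lemma conjugate_step (hD : MidpointStronglyConvex N σ D) (hσ : 0 < σ) (h0 : ∀ w, 0 ≤ D w)
    (hw₀ : D w₀ = 0) (hψ : ∀ k w, |ψ k w| ≤ B * N w) [DecidableEq ι] {a : ι → ℝ} {v : E} {τ : ℝ}
    (hv : conjugate D ψ a - τ ≤ (∑ k, a k * ψ k v) - D v) (k : ι) (t : ℝ) :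
    conjugate D ψ (a + Pi.single k t) ≤ conjugate D ψ a + τ + t * ψ k v + t ^ 2 * B ^ 2 / σ := by
  have : Nonempty E := ⟨v⟩
  refine ciSup_le fun w => ?_
  have hsum : ∑ i, (a + Pi.single k t : ι → ℝ) i * ψ i w = (∑ i, a i * ψ i w) + t * ψ k w := by
    simp [add_mul, Finset.sum_add_distrib, Pi.single_apply]
  have hm := le_ciSup (bddAbove_conjugate hD hσ h0 hw₀ hψ a) ((1 / 2 : ℝ) • (v + w))
  change _ ≤ conjugate D ψ a at hm
  have hmid : ∑ i, a i * ψ i ((1 / 2 : ℝ) • (v + w))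
      = ((∑ i, a i * ψ i v) + ∑ i, a i * ψ i w) / 2 := by
    rw [← Finset.sum_add_distrib, Finset.sum_div]
    refine Finset.sum_congr rfl fun i _ => ?_
    simp only [map_smul, map_add, smul_eq_mul]; ring
  have hc := hD v w
  have hpsi : t * (ψ k w - ψ k v) ≤ |t| * (B * N (v - w)) := by
    refine (le_abs_self _).trans ?_
    rw [abs_mul]
    refine mul_le_mul_of_nonneg_left ?_ (abs_nonneg _)
    rw [abs_sub_comm, ← map_sub]
    exact hψ k _
  have hsq : |t| * (B * N (v - w)) ≤ σ / 4 * N (v - w) ^ 2 + t ^ 2 * B ^ 2 / σ := by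
    have h4 : 0 ≤ (|t| * B / σ - N (v - w) / 2) ^ 2 * σ := by positivity
    have h5 : (|t| * B / σ - N (v - w) / 2) ^ 2 * σ
        = |t| ^ 2 * B ^ 2 / σ + σ / 4 * N (v - w) ^ 2 - |t| * (B * N (v - w)) := by
      field_simp; ring
    rw [sq_abs] at h5
    linarith
  rw [hsum]
  rw [hmid] at hm
  linarith

/-- A sublevel set of a strongly convex function is covered, uniformly over finitely many bounded
functionals, by few points: these are the approximate maximizers defining the conjugate at the
functionals which a greedy coordinate descent can reach. -/
lemma exists_finset_cover_aux (hD : MidpointStronglyConvex N σ D) (hσ : 0 < σ)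
    (h0 : ∀ w, 0 ≤ D w) (hw₀ : D w₀ = 0) (hψ : ∀ k w, |ψ k w| ≤ B * N w) (hB : 0 < B)
    {ε Λ : ℝ} (hε : 0 < ε) (m : ℕ) (hm : Λ < m * (ε ^ 2 * σ / (8 * B ^ 2))) :
    ∃ C : Finset E, C.card ≤ (2 * Fintype.card ι + 1) ^ m ∧
      ∀ u, D u ≤ Λ → ∃ v ∈ C, ∀ k, |ψ k v - ψ k u| ≤ ε := by
  classical
  set γ : ℝ := ε ^ 2 * σ / (8 * B ^ 2) with hγ
  have hγ0 : 0 < γ := by positivity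
  have : Nonempty E := ⟨w₀⟩
  have hex : ∀ a : ι → ℝ, ∃ v : E, conjugate D ψ a - γ ≤ (∑ k, a k * ψ k v) - D v := by
    intro a
    obtain ⟨v, hv⟩ := exists_lt_of_lt_ciSup
      (show conjugate D ψ a - γ < ⨆ w : E, ((∑ k, a k * ψ k w) - D w) by
        change conjugate D ψ a - γ < conjugate D ψ a
        linarith)
    exact ⟨v, hv.le⟩
  choose v hv using hex
  -- This step length maximizes `t * ε - t ^ 2 * B ^ 2 / σ`. The maximum is `2 * γ`: one `γ` pays
  -- for the approximate maximizer, the other is the net decrease per step.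
  set η : ℝ := ε * σ / (2 * B ^ 2) with hη
  have hη0 : 0 < η := by positivity
  have hηγ : η * ε - η ^ 2 * B ^ 2 / σ - γ = γ := by
    rw [hη, hγ]; field_simp; ring
  -- There are `2 * card ι + 1` moves: a signed coordinate step, or `none`, which keeps an already
  -- good point until time `m`.
  let step : Option (ι × Bool) → ι → ℝ := fun o =>
    o.elim 0 fun q => Pi.single q.1 (if q.2 then η else -η)
  have key : ∀ t : ℕ, ∃ A : Finset (ι → ℝ), A.card ≤ (2 * Fintype.card ι + 1) ^ t ∧
      ∀ u, D u ≤ Λ → ∃ a ∈ A, (∀ k, |ψ k (v a) - ψ k u| ≤ ε) ∨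
        conjugate D ψ a - ∑ k, a k * ψ k u ≤ -(t * γ) := by
    intro t
    induction t with
    | zero =>
      refine ⟨{0}, by simp, fun u _ => ⟨0, by simp, Or.inr ?_⟩⟩
      simp only [Pi.zero_apply, zero_mul, Finset.sum_const_zero, sub_zero, Nat.cast_zero, neg_zero]
      exact ciSup_le fun w => by simpa using h0 w
    | succ t ih =>
      obtain ⟨A, hA, hcov⟩ := ih
      refine ⟨Finset.image₂ (fun a o => a + step o) A Finset.univ, ?_, fun u hu => ?_⟩
      · refine (Finset.card_image₂_le _ _ _).trans ?_
        rw [pow_succ]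
        refine Nat.mul_le_mul hA ?_
        simp [Fintype.card_option, Fintype.card_prod, mul_comm]
      · obtain ⟨a, ha, hau⟩ := hcov u hu
        by_cases hgood : ∀ k, |ψ k (v a) - ψ k u| ≤ ε
        · refine ⟨a + step none, Finset.mem_image₂_of_mem ha (Finset.mem_univ _), Or.inl ?_⟩
          simpa [step] using hgood
        · have hau := hau.resolve_left hgood
          push Not at hgood
          obtain ⟨k, hk⟩ := hgood
          obtain ⟨b, hb⟩ : ∃ b : Bool,
              (if b then η else -η) * (ψ k (v a) - ψ k u) ≤ -(η * ε) := by
            rcases lt_abs.1 hk with h | h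
            · refine ⟨false, ?_⟩
              simp only [Bool.false_eq_true, if_false]
              nlinarith
            · refine ⟨true, ?_⟩
              simp only [if_true]
              nlinarith
          refine ⟨a + step (some (k, b)), Finset.mem_image₂_of_mem ha (Finset.mem_univ _),
            Or.inr ?_⟩
          have hst : step (some (k, b)) = Pi.single k (if b then η else -η) := rfl
          rw [hst]
          set s : ℝ := if b then η else -η with hs
          have hs2 : s ^ 2 = η ^ 2 := by rw [hs]; split_ifs <;> ring
          have h1 := conjugate_step hD hσ h0 hw₀ hψ (hv a) k s
          have hsum : ∑ i, (a + Pi.single k s : ι → ℝ) i * ψ i u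
              = (∑ i, a i * ψ i u) + s * ψ k u := by
            simp [add_mul, Finset.sum_add_distrib, Pi.single_apply]
          rw [hsum]
          rw [hs2] at h1
          push_cast
          rw [mul_sub] at hb
          linarith
  obtain ⟨A, hA, hcov⟩ := key m
  refine ⟨A.image v, Finset.card_image_le.trans hA, fun u hu => ?_⟩
  obtain ⟨a, ha, h | h⟩ := hcov u hu
  · exact ⟨v a, Finset.mem_image_of_mem _ ha, h⟩
  -- Fenchel's inequality keeps the gap at least `-D u ≥ -Λ`, which a decrease by `m * γ > Λ`
  -- contradicts.
  · have := le_ciSup (bddAbove_conjugate hD hσ h0 hw₀ hψ a) u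
    change _ ≤ conjugate D ψ a at this
    linarith

/-- At this radius the decrease per step is `Λ / (2 * 4 ^ j)`; since more than `Λ` in total is
required, `2 * 4 ^ j` steps just fail and `3 * 4 ^ j` suffice. For `B = 0` all functionals vanish
and one point covers. -/
lemma exists_finset_cover (hD : MidpointStronglyConvex N σ D) (hσ : 0 < σ)
    (h0 : ∀ w, 0 ≤ D w) (hw₀ : D w₀ = 0) (hψ : ∀ k w, |ψ k w| ≤ B * N w) (hB : 0 ≤ B)
    {Λ : ℝ} (hΛ : 0 < Λ) (j : ℕ) :
    ∃ C : Finset E, C.card ≤ (2 * Fintype.card ι + 1) ^ (3 * 4 ^ j) ∧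
      ∀ u, D u ≤ Λ → ∃ v ∈ C, ∀ k, |ψ k v - ψ k u| ≤ 2 * B * √(Λ / σ) / 2 ^ j := by
  rcases hB.eq_or_lt with rfl | hB
  · refine ⟨{w₀}, ?_, fun u _ => ⟨w₀, by simp, fun k => ?_⟩⟩
    · simpa using Nat.one_le_pow _ _ (by positivity)
    · rw [← map_sub]
      simpa using hψ k (w₀ - u)
  · have hs : 0 < Λ / σ := by positivity
    have hr := Real.sqrt_pos.2 hs
    refine exists_finset_cover_aux hD hσ h0 hw₀ hψ hB (by positivity) _ ?_
    have : (2 * B * √(Λ / σ) / 2 ^ j) ^ 2 * σ / (8 * B ^ 2) = Λ / (2 * 4 ^ j) := by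
      rw [div_pow, mul_pow, mul_pow, Real.sq_sqrt hs.le, ← pow_mul, mul_comm j 2, pow_mul]
      norm_num
      field_simp
      norm_num
    rw [this]
    push_cast
    have h4 : (0 : ℝ) < 4 ^ j := by positivity
    field_simp
    linarith

end Covering


/-! ### Chaining for Rademacher sums, by counting sign patterns. -/

section Chaining

/-- The sign attached to a Boolean. -/
def sign (b : Bool) : ℝ := if b then 1 else -1

variable {ι : Type*} [Fintype ι]

lemma abs_sign (b : Bool) : |sign b| = 1 := by cases b <;> simp [sign]

/-- The sum factorizes over coordinates, and `cosh t ≤ exp (t ^ 2 / 2)`. -/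
lemma sum_exp_sign_le [DecidableEq ι] (a : ι → ℝ) :
    ∑ s : ι → Bool, Real.exp (∑ i, sign (s i) * a i)
      ≤ 2 ^ Fintype.card ι * Real.exp ((∑ i, a i ^ 2) / 2) := by
  have h : ∑ s : ι → Bool, Real.exp (∑ i, sign (s i) * a i)
      = ∏ i, ∑ b : Bool, Real.exp (sign b * a i) := by
    rw [Finset.prod_univ_sum, Fintype.piFinset_univ]
    exact Finset.sum_congr rfl fun s _ => Real.exp_sum _ _
  rw [h, Finset.sum_div, Real.exp_sum, Fintype.card, ← Finset.prod_const, ← Finset.prod_mul_distrib]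
  refine Finset.prod_le_prod (fun i _ => Finset.sum_nonneg fun b _ => (Real.exp_pos _).le)
    fun i _ => ?_
  have hc := Real.cosh_le_exp_half_sq (a i)
  rw [Real.cosh_eq] at hc
  simp only [sign, Fintype.univ_bool, Finset.mem_singleton, Bool.true_eq_false, not_false_eq_true,
    Finset.sum_insert, if_true, one_mul, Finset.sum_singleton, Bool.false_eq_true, if_false,
    neg_mul]
  linarith

-- Chernoff bound: the exponential moment is taken at the optimal parameter `x / (√n * r)`, where `n
-- = card ι`.
open Classical in
lemma card_filter_sign_sum_le (a : ι → ℝ) {r x : ℝ} (hr : 0 ≤ r) (hx : 0 ≤ x)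
    (ha : ∀ i, |a i| ≤ r) (hι : 0 < Fintype.card ι) :
    ((Finset.univ.filter fun s : ι → Bool =>
        r * (√(Fintype.card ι) * x) < ∑ i, sign (s i) * a i).card : ℝ)
      ≤ 2 ^ Fintype.card ι * Real.exp (-(x ^ 2 / 2)) := by
  set n : ℝ := (Fintype.card ι : ℝ) with hn
  have hn0 : 0 < n := by rw [hn]; exact_mod_cast hι
  rcases hr.eq_or_lt with rfl | hr
  · have h0 : ∀ i, a i = 0 := fun i => abs_nonpos_iff.1 (ha i)
    simp only [h0, mul_zero, zero_mul, Finset.sum_const_zero, lt_irrefl, Finset.filter_false,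
      Finset.card_empty, Nat.cast_zero]
    positivity
  set lam : ℝ := x / (√n * r) with hlam
  have hsn : 0 < √n := Real.sqrt_pos.2 hn0
  have hlam0 : 0 ≤ lam := by positivity
  set S := Finset.univ.filter fun s : ι → Bool => r * (√n * x) < ∑ i, sign (s i) * a i
  have h1 : (S.card : ℝ) * Real.exp (x ^ 2)
      ≤ ∑ s : ι → Bool, Real.exp (∑ i, sign (s i) * (lam * a i)) := by
    rw [← nsmul_eq_mul, ← Finset.sum_const]
    refine (Finset.sum_le_sum fun s hs => ?_).trans
      (Finset.sum_le_sum_of_subset_of_nonneg (Finset.subset_univ S)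
        fun s _ _ => (Real.exp_pos _).le)
    have hs := (Finset.mem_filter.1 hs).2
    rw [Real.exp_le_exp]
    have h2 : ∑ i, sign (s i) * (lam * a i) = lam * ∑ i, sign (s i) * a i := by
      rw [Finset.mul_sum]; exact Finset.sum_congr rfl fun i _ => by ring
    have h3 : lam * (r * (√n * x)) = x ^ 2 := by rw [hlam]; field_simp
    rw [h2, ← h3]
    exact mul_le_mul_of_nonneg_left hs.le hlam0
  have h2 := h1.trans (sum_exp_sign_le _)
  have h3 : (∑ i, (lam * a i) ^ 2) ≤ x ^ 2 := by
    calc (∑ i, (lam * a i) ^ 2) ≤ ∑ _i : ι, (lam * r) ^ 2 := by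
          refine Finset.sum_le_sum fun i _ => ?_
          rw [mul_pow, mul_pow, ← sq_abs (a i)]
          gcongr
          exact ha i
      _ = x ^ 2 := by
          rw [Finset.sum_const, Finset.card_univ, nsmul_eq_mul, ← hn, hlam]
          field_simp
          rw [Real.sq_sqrt hn0.le, mul_comm]
  have h4 : (S.card : ℝ) * Real.exp (x ^ 2)
      ≤ 2 ^ Fintype.card ι * Real.exp (x ^ 2 / 2) :=
    h2.trans (by gcongr)
  have h5 : Real.exp (-(x ^ 2 / 2)) = Real.exp (x ^ 2 / 2) * (Real.exp (x ^ 2))⁻¹ := by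
    rw [← Real.exp_neg, ← Real.exp_add]; congr 1; ring
  rw [h5, ← mul_assoc, ← div_eq_mul_inv, le_div_iff₀ (Real.exp_pos _)]
  exact h4

/-- Chaining bound for signed sums over a class of vectors with polynomially growing uniform
metric entropy: all but a `δ`-fraction of the sign patterns satisfy it. -/
lemma exists_finset_sign_sum_le {W : Type*} (T : Set W) (a : W → ι → ℝ) {r A δ : ℝ} {K : ℕ}
    (hr : 0 ≤ r) (hA : 0 ≤ A) (hδ : 0 < δ) (hδ1 : δ ≤ 1) (hι : 0 < Fintype.card ι)
    (hK : 0 < K) (hK2 : √(Fintype.card ι) ≤ 2 ^ K)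
    (ha : ∀ w ∈ T, ∀ i, |a w i| ≤ r)
    (hcov : ∀ k : ℕ, ∃ C : Finset (ι → ℝ), (C.card : ℝ) ≤ Real.exp (A * 4 ^ k) ∧
      ∀ w ∈ T, ∃ c ∈ C, ∀ i, |c i - a w i| ≤ r / 2 ^ k) :
    ∃ Bad : Finset (ι → Bool), (Bad.card : ℝ) ≤ δ * 2 ^ Fintype.card ι ∧
      ∀ s ∉ Bad, ∀ w ∈ T, ∑ i, sign (s i) * a w i
        ≤ r * √(Fintype.card ι) * (1 + 8 * K * √A + 8 * √(Real.log (K / δ))) := by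
  classical
  -- The coarsest net is replaced by `{0}`, so that the chain starts at zero and the link sums
  -- telescope to the whole sum.
  have hcov' : ∀ k : ℕ, ∃ C : Finset (ι → ℝ), (C.card : ℝ) ≤ Real.exp (A * 4 ^ k) ∧
      (∀ w ∈ T, ∃ c ∈ C, ∀ i, |c i - a w i| ≤ r / 2 ^ k) ∧ (k = 0 → C = {0}) := by
    intro k
    rcases Nat.eq_zero_or_pos k with rfl | hk
    · refine ⟨{0}, ?_, fun w hw => ⟨0, by simp, fun i => ?_⟩, fun _ => rfl⟩
      · simp only [Finset.card_singleton, Nat.cast_one]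
        exact Real.one_le_exp (by positivity)
      · simpa using ha w hw i
    · obtain ⟨C, h1, h2⟩ := hcov k
      exact ⟨C, h1, h2, fun h => absurd h hk.ne'⟩
  choose C hC1 hC2 hC3 using hcov'
  set n : ℝ := (Fintype.card ι : ℝ) with hn
  have hn0 : 0 < n := by rw [hn]; exact_mod_cast hι
  set l : ℝ := Real.log (K / δ) with hl
  have hK1 : (1 : ℝ) ≤ K := by exact_mod_cast hK
  have hKδ : 1 ≤ K / δ := by rw [le_div_iff₀ hδ]; linarith
  have hl0 : 0 ≤ l := Real.log_nonneg hKδ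
  -- Half the square of `x k` must dominate the log-number of links, at most `A * 4 ^ (k + 1) + A *
  -- 4 ^ k`, plus `l`, which allots failure `δ / K` to each of the `K` levels.
  let x : ℕ → ℝ := fun k => 2 ^ (k + 2) * √A + 2 * √l
  have hx0 : ∀ k, 0 ≤ x k := fun k => by positivity
  have hx : ∀ k, A * 4 ^ (k + 1) + A * 4 ^ k + l ≤ x k ^ 2 / 2 := by
    intro k
    have h1 : x k ^ 2 = 4 ^ (k + 2) * A + 4 * l + 2 * (2 ^ (k + 2) * √A * (2 * √l)) := by
      have e1 := Real.sq_sqrt hA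
      have e2 := Real.sq_sqrt hl0
      have e3 : (4 : ℝ) ^ (k + 2) = (2 ^ (k + 2)) ^ 2 := by
        rw [← pow_mul, mul_comm, pow_mul]; norm_num
      simp only [x]
      rw [e3, add_sq, mul_pow, mul_pow, e1, e2]
      ring
    have h2 : 0 ≤ 2 * (2 ^ (k + 2) * √A * (2 * √l)) := by positivity
    have h3 : 0 ≤ A * 4 ^ k := by positivity
    rw [h1, pow_add, pow_add]
    nlinarith
  let L : ℕ → Finset ((ι → ℝ) × (ι → ℝ)) := fun k =>
    (C (k + 1) ×ˢ C k).filter fun q => ∀ i, |q.1 i - q.2 i| ≤ 2 * r / 2 ^ k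
  let bad : ℕ → (ι → ℝ) × (ι → ℝ) → Finset (ι → Bool) := fun k q =>
    Finset.univ.filter fun s => 2 * r / 2 ^ k * (√n * x k) < ∑ i, sign (s i) * (q.1 i - q.2 i)
  refine ⟨(Finset.range K).biUnion fun k => (L k).biUnion (bad k), ?_, ?_⟩
  · have hlev : ∀ k ∈ Finset.range K, (((L k).biUnion (bad k)).card : ℝ)
        ≤ δ / K * 2 ^ Fintype.card ι := by
      intro k _
      have h1 : (((L k).biUnion (bad k)).card : ℝ) ≤ ∑ q ∈ L k, ((bad k q).card : ℝ) := by
        exact_mod_cast Finset.card_biUnion_le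
      refine h1.trans ?_
      have h2 : ∀ q ∈ L k, ((bad k q).card : ℝ)
          ≤ 2 ^ Fintype.card ι * Real.exp (-(x k ^ 2 / 2)) := fun q hq =>
        card_filter_sign_sum_le (fun i => q.1 i - q.2 i) (by positivity) (hx0 k)
          (Finset.mem_filter.1 hq).2 hι
      refine (Finset.sum_le_sum h2).trans ?_
      rw [Finset.sum_const, nsmul_eq_mul]
      have h3 : ((L k).card : ℝ) ≤ Real.exp (A * 4 ^ (k + 1)) * Real.exp (A * 4 ^ k) := by
        have : ((L k).card : ℝ) ≤ ((C (k + 1)).card : ℝ) * (C k).card := by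
          exact_mod_cast (Finset.card_filter_le _ _).trans (Finset.card_product _ _).le
        refine this.trans ?_
        gcongr
        · exact hC1 _
        · exact hC1 _
      have h4 : Real.exp (-(x k ^ 2 / 2))
          ≤ Real.exp (-(A * 4 ^ (k + 1) + A * 4 ^ k)) * (δ / K) := by
        have : δ / K = Real.exp (-l) := by
          rw [Real.exp_neg, hl, Real.exp_log (by linarith), inv_div]
        rw [this, ← Real.exp_add, Real.exp_le_exp]
        linarith [hx k]
      calc ((L k).card : ℝ) * (2 ^ Fintype.card ι * Real.exp (-(x k ^ 2 / 2)))
          ≤ (Real.exp (A * 4 ^ (k + 1)) * Real.exp (A * 4 ^ k)) *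
            (2 ^ Fintype.card ι * (Real.exp (-(A * 4 ^ (k + 1) + A * 4 ^ k)) * (δ / K))) := by
            gcongr
        _ = δ / K * 2 ^ Fintype.card ι := by
            rw [← Real.exp_add, Real.exp_neg]
            field_simp
    have h1 : (((Finset.range K).biUnion fun k => (L k).biUnion (bad k)).card : ℝ)
        ≤ ∑ k ∈ Finset.range K, (((L k).biUnion (bad k)).card : ℝ) := by
      exact_mod_cast Finset.card_biUnion_le
    refine (h1.trans (Finset.sum_le_sum hlev)).trans (le_of_eq ?_)
    rw [Finset.sum_const, Finset.card_range, nsmul_eq_mul]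
    field_simp
  · intro s hs w hw
    choose c hc1 hc2 using fun k => hC2 k w hw
    have hlink : ∀ k < K, ∑ i, sign (s i) * (c (k + 1) i - c k i)
        ≤ 2 * r / 2 ^ k * (√n * x k) := by
      intro k hk
      by_contra hlt
      push Not at hlt
      refine hs (Finset.mem_biUnion.2 ⟨k, Finset.mem_range.2 hk, Finset.mem_biUnion.2
        ⟨(c (k + 1), c k), Finset.mem_filter.2
          ⟨Finset.mem_product.2 ⟨hc1 _, hc1 _⟩, fun i => ?_⟩, ?_⟩⟩)
      · have h1 := hc2 (k + 1) i
        have h2 := hc2 k i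
        have h3 : r / 2 ^ (k + 1) ≤ r / 2 ^ k := by
          gcongr
          · norm_num
          · omega
        have h4 : |c (k + 1) i - c k i| ≤ |c (k + 1) i - a w i| + |c k i - a w i| := by
          have := abs_sub (c (k + 1) i - a w i) (c k i - a w i)
          rwa [sub_sub_sub_cancel_right] at this
        have h5 : 2 * r / 2 ^ k = r / 2 ^ k + r / 2 ^ k := by ring
        dsimp only
        linarith
      · exact Finset.mem_filter.2 ⟨Finset.mem_univ _, hlt⟩
    -- Link size `2 * r / 2 ^ k` times `x k` gives `8 * r * √A` at every scale, whence the factor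
    -- `K`; the confidence terms decay geometrically.
    have htel : ∀ M : ℕ, M ≤ K → ∑ i, sign (s i) * c M i
        ≤ r * √n * (8 * M * √A + 8 * √l * (1 - 1 / 2 ^ M)) := by
      intro M
      induction M with
      | zero =>
        intro _
        have h0 : c 0 = 0 := by
          have := hc1 0
          rw [hC3 0 rfl] at this
          simpa using this
        simp [h0]
      | succ M ih =>
        intro hM
        have h1 := ih (by omega)
        have h2 := hlink M (by omega)
        have h3 : ∑ i, sign (s i) * c (M + 1) i
            = ∑ i, sign (s i) * c M i + ∑ i, sign (s i) * (c (M + 1) i - c M i) := by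
          rw [← Finset.sum_add_distrib]
          exact Finset.sum_congr rfl fun i _ => by ring
        have h4 : 2 * r / 2 ^ M * (√n * x M) = r * √n * (8 * √A + 8 * √l * (1 / 2 ^ (M + 1))) := by
          simp only [x]
          rw [pow_add, pow_add]
          field_simp
          ring
        rw [h3]
        refine (add_le_add h1 (h2.trans_eq h4)).trans_eq ?_
        push_cast
        rw [pow_add]
        field_simp
        ring
    -- Below the last scale no probability is needed: the trivial bound `n * r / 2 ^ K` is at most
    -- `r * √n`.
    have hlast : ∑ i, sign (s i) * (a w i - c K i) ≤ r * √n := by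
      calc ∑ i, sign (s i) * (a w i - c K i) ≤ ∑ _i : ι, r / 2 ^ K := by
            refine Finset.sum_le_sum fun i _ => (le_abs_self _).trans ?_
            rw [abs_mul, abs_sign, one_mul, abs_sub_comm]
            exact hc2 K i
        _ = r * (n / 2 ^ K) := by
            rw [Finset.sum_const, Finset.card_univ, nsmul_eq_mul, ← hn]; ring
        _ ≤ r * √n := by
            gcongr
            rw [div_le_iff₀ (by positivity)]
            calc n = √n * √n := (Real.mul_self_sqrt hn0.le).symm
              _ ≤ √n * 2 ^ K := by gcongr
    have h3 : ∑ i, sign (s i) * a w i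
        = ∑ i, sign (s i) * c K i + ∑ i, sign (s i) * (a w i - c K i) := by
      rw [← Finset.sum_add_distrib]
      exact Finset.sum_congr rfl fun i _ => by ring
    have h5 : r * √n * (8 * K * √A + 8 * √l * (1 - 1 / 2 ^ K))
        ≤ r * √n * (8 * K * √A + 8 * √l) := by
      have : (0 : ℝ) ≤ 1 / 2 ^ K := by positivity
      have h6 : 0 ≤ 8 * √l := by positivity
      refine mul_le_mul_of_nonneg_left ?_ (by positivity)
      nlinarith
    have h7 := htel K le_rfl
    rw [h3]
    linarith

end Chaining


/-! ### Ghost sample, random swaps and the uniform deviation inequality. -/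

section Symmetrization

variable {ι Z : Type*} [Fintype ι] [MeasurableSpace Z] {ρ : Measure Z} [IsProbabilityMeasure ρ]

/-- Chebyshev's inequality: the variance of the sum is at most `card ι * b ^ 2 ≤ q ^ 2 / 2`. The
case `q = 0` is separate because Chebyshev divides by `q ^ 2`. -/
lemma one_half_le_measure_sum_ge {f : Z → ℝ} (hf : Measurable f) {b q : ℝ}
    (hb : ∀ z, |f z| ≤ b) (hq : 0 ≤ q) (hbq : 2 * (Fintype.card ι * b ^ 2) ≤ q ^ 2) :
    (1 / 2 : ENNReal) ≤ Measure.pi (fun _ : ι => ρ)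
      {S | Fintype.card ι * ∫ z, f z ∂ρ - q ≤ ∑ i, f (S i)} := by
  set μ := Measure.pi (fun _ : ι => ρ)
  have hmeas : Measurable fun S : ι → Z => ∑ i, f (S i) :=
    Finset.measurable_sum _ fun i _ => hf.comp (measurable_pi_apply i)
  have hL2 : MemLp f 2 ρ := MemLp.of_bound hf.aestronglyMeasurable b (.of_forall hb)
  have hint : Integrable f ρ := hL2.integrable (by norm_num)
  rcases hq.eq_or_lt with rfl | hq
  · have h0 : ∀ S : ι → Z, ∑ i, f (S i) = 0 ∧ Fintype.card ι * ∫ z, f z ∂ρ = 0 := by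
      intro S
      rcases Nat.eq_zero_or_pos (Fintype.card ι) with h | h
      · have := Fintype.card_eq_zero_iff.1 h
        simp
      · have hb0 : b ^ 2 ≤ 0 := by
          have : (1 : ℝ) ≤ Fintype.card ι := by exact_mod_cast h
          nlinarith [sq_nonneg b]
        have hb0 : b = 0 := by nlinarith
        have hf0 : ∀ z, f z = 0 := fun z => abs_nonpos_iff.1 (hb0 ▸ hb z)
        simp [hf0]
    have : {S : ι → Z | Fintype.card ι * ∫ z, f z ∂ρ - 0 ≤ ∑ i, f (S i)} = Set.univ := by
      ext S; simp [(h0 S).1, (h0 S).2]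
    rw [this, measure_univ]
    norm_num
  have hsum2 : MemLp (∑ i, fun S : ι → Z => f (S i)) 2 μ :=
    memLp_finsetSum' _ fun i _ => hL2.comp_measurePreserving (measurePreserving_eval _ i)
  have hvar : ProbabilityTheory.variance (∑ i, fun S : ι → Z => f (S i)) μ
      ≤ Fintype.card ι * b ^ 2 := by
    rw [ProbabilityTheory.variance_sum_pi fun _ => hL2, Finset.sum_const, Finset.card_univ,
      nsmul_eq_mul]
    gcongr
    refine (ProbabilityTheory.variance_le_sq_of_bounded
      (.of_forall fun z => abs_le.1 (hb z)) hf.aemeasurable).trans_eq ?_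
    ring
  have hmean : ∫ S, (∑ i, fun S : ι → Z => f (S i)) S ∂μ = Fintype.card ι * ∫ z, f z ∂ρ := by
    simp only [Finset.sum_apply]
    have hi : ∀ i ∈ Finset.univ, Integrable (fun S : ι → Z => f (S i)) μ := fun i _ =>
      (measurePreserving_eval (fun _ : ι => ρ) i).integrable_comp_of_integrable hint
    rw [integral_finsetSum _ hi]
    simp only [μ, integral_comp_eval (μ := fun _ : ι => ρ) hint.aestronglyMeasurable,
      Finset.sum_const, Finset.card_univ, nsmul_eq_mul]
  have hcheb := ProbabilityTheory.meas_ge_le_variance_div_sq hsum2 hq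
  rw [hmean] at hcheb
  have hhalf : μ {S | Fintype.card ι * ∫ z, f z ∂ρ - q ≤ ∑ i, f (S i)}ᶜ ≤ 1 / 2 := by
    calc μ {S | Fintype.card ι * ∫ z, f z ∂ρ - q ≤ ∑ i, f (S i)}ᶜ
        ≤ _ := measure_mono (fun S hS => ?_)
      _ ≤ _ := hcheb
      _ ≤ ENNReal.ofReal (1 / 2) := by
          refine ENNReal.ofReal_le_ofReal ?_
          rw [div_le_iff₀ (by positivity)]
          linarith
      _ = 1 / 2 := by
          rw [ENNReal.ofReal_div_of_pos (by norm_num)]; simp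
    simp only [Set.mem_compl_iff, Set.mem_ofPred_eq, not_le] at hS
    simp only [Set.mem_ofPred_eq, Finset.sum_apply]
    rw [abs_sub_comm]
    exact (le_abs_self _).trans' (by linarith)
  have hms : MeasurableSet {S : ι → Z | Fintype.card ι * ∫ z, f z ∂ρ - q ≤ ∑ i, f (S i)} :=
    measurableSet_le measurable_const hmeas
  have hadd := prob_add_prob_compl (μ := μ) hms
  by_contra hlt
  push Not at hlt
  have : μ {S | Fintype.card ι * ∫ z, f z ∂ρ - q ≤ ∑ i, f (S i)}
      + μ {S | Fintype.card ι * ∫ z, f z ∂ρ - q ≤ ∑ i, f (S i)}ᶜ < 1 / 2 + 1 / 2 :=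
    ENNReal.add_lt_add_of_lt_of_le (by finiteness) hlt hhalf
  rw [hadd, ENNReal.add_halves] at this
  exact lt_irrefl _ this

/-- Symmetrization by a ghost sample. -/
lemma measure_exists_lt_le_two_mul {W : Type*} {T : Set W} (hT : T.Countable) {f : W → Z → ℝ}
    (hf : ∀ w, Measurable (f w)) {b q : ℝ} (hb : ∀ w ∈ T, ∀ z, |f w z| ≤ b) (hq : 0 ≤ q)
    (hbq : 2 * (Fintype.card ι * b ^ 2) ≤ q ^ 2) :
    Measure.pi (fun _ : ι => ρ)
        {S | ∃ w ∈ T, 2 * q < Fintype.card ι * ∫ z, f w z ∂ρ - ∑ i, f w (S i)}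
      ≤ 2 * Measure.pi (fun _ : ι => ρ.prod ρ)
        {p | ∃ w ∈ T, q < ∑ i, (f w (p i).2 - f w (p i).1)} := by
  set μ := Measure.pi (fun _ : ι => ρ) with hμ
  have hsum : ∀ w, Measurable fun S : ι → Z => ∑ i, f w (S i) := fun w =>
    Finset.measurable_sum _ fun i _ => (hf w).comp (measurable_pi_apply i)
  let E : Set ((ι → Z) × (ι → Z)) :=
    {p | ∃ w ∈ T, q < ∑ i, f w (p.2 i) - ∑ i, f w (p.1 i)}
  have hE : MeasurableSet E := by
    have : E = ⋃ w ∈ T, {p | q < ∑ i, f w (p.2 i) - ∑ i, f w (p.1 i)} := by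
      ext p; simp [E]
    rw [this]
    exact MeasurableSet.biUnion hT fun w _ => measurableSet_lt measurable_const
      (((hsum w).comp measurable_snd).sub ((hsum w).comp measurable_fst))
  have hEq : Measure.pi (fun _ : ι => ρ.prod ρ)
      {p | ∃ w ∈ T, q < ∑ i, (f w (p i).2 - f w (p i).1)} = (μ.prod μ) E := by
    rw [← (measurePreserving_arrowProdEquivProdArrow Z Z ι (fun _ => ρ)
      (fun _ => ρ)).measure_preimage hE.nullMeasurableSet]
    congr 1
    ext p
    simp [E, MeasurableEquiv.arrowProdEquivProdArrow, Equiv.arrowProdEquivProdArrow]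
  rw [hEq, Measure.prod_apply hE]
  set Bd : Set (ι → Z) :=
    {S | ∃ w ∈ T, 2 * q < Fintype.card ι * ∫ z, f w z ∂ρ - ∑ i, f w (S i)}
  have hBd : MeasurableSet Bd := by
    have : Bd = ⋃ w ∈ T, {S | 2 * q < Fintype.card ι * ∫ z, f w z ∂ρ - ∑ i, f w (S i)} := by
      ext p; simp [Bd]
    rw [this]
    exact MeasurableSet.biUnion hT fun w _ => measurableSet_lt measurable_const
      (measurable_const.sub (hsum w))
  have hfib : ∫⁻ _ in Bd, (1 / 2 : ENNReal) ∂μ ≤ ∫⁻ S, μ (Prod.mk S ⁻¹' E) ∂μ := by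
    rw [← lintegral_indicator hBd]
    refine lintegral_mono fun S => ?_
    by_cases hS : S ∈ Bd
    · rw [Set.indicator_of_mem hS]
      -- The witness `w` depends on `S` alone, so with probability at least `1/2` an independent
      -- ghost sum lies above the mean minus `q`, leaving a difference exceeding `q`.
      obtain ⟨w, hw, hlt⟩ := hS
      refine (one_half_le_measure_sum_ge (hf w) (hb w hw) hq hbq).trans (measure_mono ?_)
      intro S' hS'
      have hS' : Fintype.card ι * ∫ z, f w z ∂ρ - q ≤ ∑ i, f w (S' i) := hS'
      exact ⟨w, hw, by dsimp only; linarith⟩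
    · rw [Set.indicator_of_notMem hS]
      exact zero_le
  rw [lintegral_const, Measure.restrict_apply_univ] at hfib
  calc μ Bd = 2 * (1 / 2 * μ Bd) := by
        rw [← mul_assoc, ENNReal.mul_div_cancel (by norm_num) (by norm_num), one_mul]
    _ ≤ _ := by gcongr

/-- Exchanges the two entries of the pairs whose index has sign `-1`. -/
def swapPairs (s : ι → Bool) (p : ι → Z × Z) : ι → Z × Z :=
  fun i => if s i then p i else (p i).swap

lemma measurePreserving_swapPairs (s : ι → Bool) :
    MeasurePreserving (swapPairs (Z := Z) s) (Measure.pi fun _ => ρ.prod ρ)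
      (Measure.pi fun _ => ρ.prod ρ) := by
  refine measurePreserving_pi (f := fun i (z : Z × Z) => if s i then z else z.swap) _ _ fun i => ?_
  cases s i
  · simpa using Measure.measurePreserving_swap
  · simpa using! MeasurePreserving.id (ρ.prod ρ)

/-- Every swap preserves the product measure, so the measure of `E` is the integral over `p` of the
fraction of swaps sending `p` into `E`. It thus suffices to treat the signs with the pairs frozen.
-/
lemma measure_le_of_swapPairs {E : Set (ι → Z × Z)} (hE : MeasurableSet E) {δ : ℝ}
    (h : ∀ p, ∃ Bad : Finset (ι → Bool), (Bad.card : ℝ) ≤ δ * 2 ^ Fintype.card ι ∧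
      ∀ s ∉ Bad, swapPairs s p ∉ E) :
    Measure.pi (fun _ : ι => ρ.prod ρ) E ≤ ENNReal.ofReal δ := by
  classical
  set ν := Measure.pi (fun _ : ι => ρ.prod ρ) with hν
  have h1 : (2 ^ Fintype.card ι : ENNReal) * ν E
      = ∑ s : ι → Bool, ∫⁻ p, E.indicator 1 (swapPairs s p) ∂ν := by
    have : ∀ s : ι → Bool, ∫⁻ p, E.indicator 1 (swapPairs s p) ∂ν = ν E := by
      intro s
      rw [(measurePreserving_swapPairs s).lintegral_comp
        (measurable_one.indicator hE), lintegral_indicator_one hE]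
    simp [this]
  have hmeas : ∀ s ∈ Finset.univ, Measurable fun p : ι → Z × Z =>
      E.indicator (1 : (ι → Z × Z) → ENNReal) (swapPairs s p) := fun s _ =>
    (measurable_one.indicator hE).comp (measurePreserving_swapPairs (ρ := ρ) s).measurable
  rw [← lintegral_finsetSum _ hmeas] at h1
  have h2 : ∀ p, ∑ s : ι → Bool, E.indicator (1 : (ι → Z × Z) → ENNReal) (swapPairs s p)
      ≤ ENNReal.ofReal (δ * 2 ^ Fintype.card ι) := by
    intro p
    obtain ⟨Bad, hc, hB⟩ := h p
    calc ∑ s : ι → Bool, E.indicator (1 : (ι → Z × Z) → ENNReal) (swapPairs s p)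
        ≤ ∑ s : ι → Bool, if s ∈ Bad then 1 else 0 := by
          refine Finset.sum_le_sum fun s _ => ?_
          split_ifs with hs
          · exact Set.indicator_le_self' (fun _ _ => zero_le) _
          · rw [Set.indicator_of_notMem (hB s hs)]
      _ = (Bad.card : ENNReal) := by simp
      _ ≤ _ := by
          rw [← ENNReal.ofReal_natCast]
          exact ENNReal.ofReal_le_ofReal hc
  have h3 : (2 ^ Fintype.card ι : ENNReal) * ν E ≤ ENNReal.ofReal (δ * 2 ^ Fintype.card ι) := by
    rw [h1]
    refine (lintegral_mono h2).trans ?_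
    simp
  rw [mul_comm δ, ENNReal.ofReal_mul (by positivity), ENNReal.ofReal_pow (by norm_num),
    ENNReal.ofReal_ofNat] at h3
  exact (ENNReal.mul_le_mul_iff_right (by positivity) (by finiteness)).1 h3

/-- One-sided uniform deviation inequality for a countable bounded class whose increments over any
sample of pairs have polynomially growing uniform metric entropy. -/
lemma measure_exists_deviation_lt_le {W : Type*} {T : Set W} (hT : T.Countable) {f : W → Z → ℝ}
    (hf : ∀ w, Measurable (f w)) {b A δ : ℝ} {K : ℕ} (hb0 : 0 ≤ b)
    (hb : ∀ w ∈ T, ∀ z, |f w z| ≤ b) (hA : 0 ≤ A) (hδ : 0 < δ) (hδ1 : δ ≤ 1)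
    (hι : 0 < Fintype.card ι) (hK : 0 < K) (hK2 : √(Fintype.card ι) ≤ 2 ^ K)
    (hcov : ∀ (p : ι → Z × Z) (k : ℕ), ∃ C : Finset (ι → ℝ),
      (C.card : ℝ) ≤ Real.exp (A * 4 ^ k) ∧
      ∀ w ∈ T, ∃ c ∈ C, ∀ i, |c i - (f w (p i).2 - f w (p i).1)| ≤ 2 * b / 2 ^ k) :
    Measure.pi (fun _ : ι => ρ)
        {S | ∃ w ∈ T, 4 * b * √(Fintype.card ι) * (1 + 8 * K * √A + 8 * √(Real.log (2 * K / δ)))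
          < Fintype.card ι * ∫ z, f w z ∂ρ - ∑ i, f w (S i)}
      ≤ ENNReal.ofReal δ := by
  set q : ℝ := 2 * b * √(Fintype.card ι) * (1 + 8 * K * √A + 8 * √(Real.log (2 * K / δ))) with hq
  have hq1 : 2 * b * √(Fintype.card ι) ≤ q := by
    rw [hq]
    refine le_mul_of_one_le_right (by positivity) ?_
    have h1 : 0 ≤ 8 * K * √A := by positivity
    have h2 : 0 ≤ 8 * √(Real.log (2 * K / δ)) := by positivity
    linarith
  have hq0 : 0 ≤ q := hq1.trans' (by positivity)
  have hbq : 2 * (Fintype.card ι * b ^ 2) ≤ q ^ 2 := by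
    have h1 : (2 * b * √(Fintype.card ι)) ^ 2 ≤ q ^ 2 := by gcongr
    rw [mul_pow, Real.sq_sqrt (by positivity)] at h1
    have : (0 : ℝ) ≤ Fintype.card ι * b ^ 2 := by positivity
    nlinarith
  have h1 := measure_exists_lt_le_two_mul (ρ := ρ) hT hf hb hq0 hbq
  have hE : MeasurableSet {p : ι → Z × Z | ∃ w ∈ T, q < ∑ i, (f w (p i).2 - f w (p i).1)} := by
    have : {p : ι → Z × Z | ∃ w ∈ T, q < ∑ i, (f w (p i).2 - f w (p i).1)}
        = ⋃ w ∈ T, {p : ι → Z × Z | q < ∑ i, (f w (p i).2 - f w (p i).1)} := by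
      ext p; simp
    rw [this]
    refine MeasurableSet.biUnion hT fun w _ => measurableSet_lt measurable_const ?_
    have := hf w
    fun_prop
  -- The ghost sample doubles the probability, hence `δ / 2` here; it also doubles the threshold,
  -- and the increments have range `2 * b`, hence the factor `4 * b` in the conclusion.
  have h2 : Measure.pi (fun _ : ι => ρ.prod ρ)
      {p | ∃ w ∈ T, q < ∑ i, (f w (p i).2 - f w (p i).1)} ≤ ENNReal.ofReal (δ / 2) := by
    refine measure_le_of_swapPairs hE fun p => ?_
    obtain ⟨Bad, hc, hB⟩ := exists_finset_sign_sum_le T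
      (fun w i => f w (p i).2 - f w (p i).1) (r := 2 * b) (A := A) (δ := δ / 2) (K := K)
      (by positivity) hA (by positivity) (by linarith) hι hK hK2
      (fun w hw i => by
        have h1 := abs_sub (f w (p i).2) (f w (p i).1)
        have h2 := hb w hw (p i).1
        have h3 := hb w hw (p i).2
        linarith) (hcov p)
    refine ⟨Bad, hc, fun s hs => ?_⟩
    rintro ⟨w, hw, hlt⟩
    refine hlt.not_ge ?_
    have h3 := hB s hs w hw
    have h4 : (K : ℝ) / (δ / 2) = 2 * K / δ := by field_simp
    rw [h4] at h3
    refine le_trans (le_of_eq ?_) h3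
    refine Finset.sum_congr rfl fun i _ => ?_
    cases hsi : s i <;> simp [swapPairs, sign, hsi]
  have h3 : 4 * b * √(Fintype.card ι) * (1 + 8 * K * √A + 8 * √(Real.log (2 * K / δ))) = 2 * q := by
    rw [hq]; ring
  rw [h3]
  refine h1.trans ((mul_le_mul_right h2 2).trans_eq ?_)
  rw [ENNReal.ofReal_div_of_pos (by norm_num), ENNReal.ofReal_ofNat,
    ENNReal.mul_div_cancel (by norm_num) (by norm_num)]

end Symmetrization


/-! ### Separability of the kernel space and bounds on predictions. -/

section FeatureMap

variable {X H : Type*} [NormedAddCommGroup H] [InnerProductSpace ℝ H] [CompleteSpace H]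
  [RKHS ℝ H X ℝ]

lemma continuous_featureMap [TopologicalSpace X]
    (hK : Continuous fun q : X × X => kernelFun H q.1 q.2) :
    Continuous (featureMap H : X → H) := by
  rw [continuous_iff_continuousAt]
  intro x
  rw [ContinuousAt, tendsto_iff_norm_sub_tendsto_zero]
  have h1 : ∀ y, ‖featureMap H y - featureMap H x‖
      = √(kernelFun H y y - 2 * kernelFun H y x + kernelFun H x x) := by
    intro y
    rw [kernelFun, kernelFun, kernelFun, real_inner_self_eq_norm_sq, real_inner_self_eq_norm_sq,
      ← norm_sub_sq_real, Real.sqrt_sq (norm_nonneg _)]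
  have h2 : Continuous fun y => √(kernelFun H y y - 2 * kernelFun H y x + kernelFun H x x) := by
    have e1 : Continuous fun y : X => kernelFun H y y := by
      have hyy : Continuous fun y : X => (y, y) := by fun_prop
      simpa only using hK.comp' hyy
    have e2 : Continuous fun y : X => kernelFun H y x := by
      have hyx : Continuous fun y : X => (y, x) := by fun_prop
      simpa only using hK.comp' hyx
    exact ((e1.sub (continuous_const.mul e2)).add continuous_const).sqrt
  simp_rw [h1]
  have h3 := h2.tendsto x
  have h4 : kernelFun H x x - 2 * kernelFun H x x + kernelFun H x x = 0 := by ring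
  rwa [h4, Real.sqrt_zero] at h3

/-- The features form a continuous image of a separable space and span a dense subspace.
Separability later allows a countable subclass, which makes the deviation events measurable. -/
lemma separableSpace_of_continuous_kernel [TopologicalSpace X] [TopologicalSpace.SeparableSpace X]
    (hK : Continuous fun q : X × X => kernelFun H q.1 q.2) :
    TopologicalSpace.SeparableSpace H := by
  have h1 : TopologicalSpace.IsSeparable (Set.range (featureMap H : X → H)) :=
    TopologicalSpace.isSeparable_range (continuous_featureMap hK)
  have h2 := (h1.span (R := ℝ)).closure
  have h3 : closure (Submodule.span ℝ (Set.range (featureMap H : X → H)) : Set H)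
      = Set.univ := by
    have hd := RKHS.kerFun_dense (𝕜 := ℝ) (H := H) (X := X) (V := ℝ)
    rw [← Submodule.topologicalClosure_coe, ← Submodule.top_coe (R := ℝ), ← hd]
    congr 2
    apply le_antisymm
    · refine Submodule.span_mono ?_
      rintro _ ⟨x, rfl⟩
      exact ⟨x, 1, rfl⟩
    · rw [Submodule.span_le]
      rintro _ ⟨x, v, rfl⟩
      have : RKHS.kerFun H x v = v • featureMap H x := by
        rw [featureMap, ← map_smul, smul_eq_mul, mul_one]
      rw [this]
      exact Submodule.smul_mem _ _ (Submodule.subset_span ⟨x, rfl⟩)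
  rw [h3] at h2
  exact TopologicalSpace.isSeparable_univ_iff.1 h2

variable {c : ℕ} {N : Seminorm ℝ (Fin c → H)} {κ : ℝ}

lemma innerProd_featureAt (w : Fin c → H) (j : Fin c) (x : X) :
    innerProd w (featureAt H j x) = predictor w x j := by
  rw [innerProd, Finset.sum_eq_single j]
  · simp [featureAt, predictor]
  · intro i _ hi
    simp [featureAt, hi]
  · simp

/-- The prediction for label `j` at `x`, as a linear functional of the hypothesis. -/
def predictorFunctional (x : X) (j : Fin c) : (Fin c → H) →ₗ[ℝ] ℝ where
  toFun w := predictor w x j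
  map_add' w v := by simp [predictor, inner_add_left]
  map_smul' a w := by simp [predictor, inner_smul_left]

@[simp]
lemma predictorFunctional_apply (x : X) (j : Fin c) (w : Fin c → H) :
    predictorFunctional x j w = predictor w x j := rfl

lemma abs_predictor_le (hκ : ∀ x : X, ‖featureMap H x‖ ≤ κ) (w : Fin c → H) (x : X)
    (j : Fin c) : |predictor w x j| ≤ ‖w j‖ * κ :=
  (abs_real_inner_le_norm _ _).trans (by gcongr; exact hκ x)

/-- This makes the suprema in `dualNorm` and `Btilde` genuine instead of the default value `0` of an
unbounded real supremum. -/
lemma bddAbove_dualNorm_featureAt (hκ : ∀ x : X, ‖featureMap H x‖ ≤ κ)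
    (hN : DominatesTwoInfty N) (j : Fin c) (x : X) :
    κ ∈ upperBounds {t : ℝ | ∃ w : Fin c → H, N w ≤ 1 ∧ t = innerProd w (featureAt H j x)} := by
  rintro _ ⟨w, hw, rfl⟩
  rw [innerProd_featureAt]
  have hκ0 : 0 ≤ κ := (norm_nonneg _).trans (hκ x)
  calc predictor w x j ≤ ‖w j‖ * κ := (le_abs_self _).trans (abs_predictor_le hκ w x j)
    _ ≤ 1 * κ := by gcongr; exact (hN w j).trans hw
    _ = κ := one_mul κ

lemma dualNorm_featureAt_le (hκ : ∀ x : X, ‖featureMap H x‖ ≤ κ)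
    (hN : DominatesTwoInfty N) (j : Fin c) (x : X) : dualNorm N (featureAt H j x) ≤ κ :=
  csSup_le ⟨0, 0, by simp, by simp [innerProd]⟩ (bddAbove_dualNorm_featureAt hκ hN j x)

lemma dualNorm_featureAt_le_Btilde (hκ : ∀ x : X, ‖featureMap H x‖ ≤ κ)
    (hN : DominatesTwoInfty N) (j : Fin c) (x : X) :
    dualNorm N (featureAt H j x) ≤ Btilde N := by
  refine le_ciSup (f := fun p : X × Fin c => dualNorm N (featureAt H p.2 p.1)) ⟨κ, ?_⟩ (x, j)
  rintro _ ⟨p, rfl⟩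
  exact dualNorm_featureAt_le hκ hN p.2 p.1

lemma Btilde_nonneg (hκ : ∀ x : X, ‖featureMap H x‖ ≤ κ) (hN : DominatesTwoInfty N) :
    0 ≤ Btilde N :=
  Real.iSup_nonneg fun p => le_csSup ⟨κ, bddAbove_dualNorm_featureAt hκ hN p.2 p.1⟩
    ⟨0, by simp, by simp [innerProd]⟩

lemma Btilde_le (hκ0 : 0 ≤ κ) (hκ : ∀ x : X, ‖featureMap H x‖ ≤ κ) (hN : DominatesTwoInfty N) :
    Btilde N ≤ κ :=
  Real.iSup_le (fun p => dualNorm_featureAt_le hκ hN p.2 p.1) hκ0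

/-- Duality after normalizing `w`; if `N w = 0`, domination of the component norms forces `w j = 0`.
-/
lemma predictor_le_Btilde_mul (hκ : ∀ x : X, ‖featureMap H x‖ ≤ κ) (hN : DominatesTwoInfty N)
    (w : Fin c → H) (x : X) (j : Fin c) : predictor w x j ≤ Btilde N * N w := by
  rcases (apply_nonneg N w).eq_or_lt with h0 | h0
  · have hw : w j = 0 := norm_le_zero_iff.1 ((hN w j).trans h0.symm.le)
    simp [predictor, hw, ← h0]
  · have h1 : innerProd ((N w)⁻¹ • w) (featureAt H j x) ≤ dualNorm N (featureAt H j x) := by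
      refine le_csSup ⟨κ, bddAbove_dualNorm_featureAt hκ hN j x⟩ ⟨_, ?_, rfl⟩
      rw [map_smul_eq_mul, norm_inv, Real.norm_of_nonneg h0.le, inv_mul_cancel₀ h0.ne']
    have h2 := h1.trans (dualNorm_featureAt_le_Btilde hκ hN j x)
    rw [innerProd_featureAt, ← predictorFunctional_apply, map_smul, smul_eq_mul,
      inv_mul_le_iff₀ h0] at h2
    rwa [mul_comm]

lemma abs_predictor_le_Btilde_mul (hκ : ∀ x : X, ‖featureMap H x‖ ≤ κ)
    (hN : DominatesTwoInfty N) (w : Fin c → H) (x : X) (j : Fin c) :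
    |predictor w x j| ≤ Btilde N * N w := by
  refine abs_le'.2 ⟨predictor_le_Btilde_mul hκ hN w x j, ?_⟩
  have h := predictor_le_Btilde_mul hκ hN (-w) x j
  rwa [← predictorFunctional_apply, map_neg, map_neg_eq_map] at h

end FeatureMap

/-! ### Uniform deviation on a sublevel set of the excess risk. -/

section Deviation

/-- The assumptions on a regularized learning problem with a loss that is Lipschitz with respect to
the `ℓ_∞` norm of the predictions and a strongly convex regularizer. -/
structure IsRegularizedProblem {X Y H : Type*} [MeasurableSpace X] [MeasurableSpace Y]
    [NormedAddCommGroup H] [InnerProductSpace ℝ H] [CompleteSpace H] [RKHS ℝ H X ℝ] {c : ℕ}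
    (L κ σ : ℝ) (ρ : Measure (X × Y)) (loss : (Fin c → H) → X × Y → ℝ) (r : (Fin c → H) → ℝ)
    (N : Seminorm ℝ (Fin c → H)) (wstar : Fin c → H) : Prop where
  L_pos : 0 < L
  κ_nonneg : 0 ≤ κ
  σ_pos : 0 < σ
  feature_le : ∀ x : X, ‖featureMap H x‖ ≤ κ
  measurable_loss : ∀ w, Measurable (loss w)
  integrable_loss : ∀ w, Integrable (loss w) ρ
  lipschitz : IsLipschitzLoss L loss
  convex_loss : ∀ z, ConvexOn ℝ Set.univ fun w => loss w z
  dominates : DominatesTwoInfty N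
  stronglyConvex : IsStronglyConvex N σ r
  isMin : ∀ w, regularizedRisk ρ loss r wstar ≤ regularizedRisk ρ loss r w

/-- The excess regularized risk of `w` relative to `w'`. -/
def excessRisk {W Z : Type*} [MeasurableSpace Z] (ρ : Measure Z) (loss : W → Z → ℝ) (r : W → ℝ)
    (w' w : W) : ℝ := regularizedRisk ρ loss r w - regularizedRisk ρ loss r w'

/-- The subgradient inequalities at the midpoint are averaged over the two endpoints; the linear
terms cancel. -/
lemma IsStronglyConvex.midpoint {H : Type*} [NormedAddCommGroup H] [InnerProductSpace ℝ H] {c : ℕ}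
    {N : Seminorm ℝ (Fin c → H)} {σ : ℝ} {r : (Fin c → H) → ℝ} (hr : IsStronglyConvex N σ r) :
    MidpointStronglyConvex N σ r := by
  intro w w'
  obtain ⟨g, hg⟩ := hr ((1 / 2 : ℝ) • (w + w'))
  have h1 := hg w
  have h2 := hg w'
  have e1 : w - (1 / 2 : ℝ) • (w + w') = (1 / 2 : ℝ) • (w - w') := by module
  have e2 : w' - (1 / 2 : ℝ) • (w + w') = -((1 / 2 : ℝ) • (w - w')) := by module
  rw [e1] at h1
  rw [e2] at h2
  have e3 : innerProd (-((1 / 2 : ℝ) • (w - w'))) g = -innerProd ((1 / 2 : ℝ) • (w - w')) g := by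
    simp [innerProd]
  have e4 : N ((1 / 2 : ℝ) • (w - w')) = 1 / 2 * N (w - w') := by
    rw [map_smul_eq_mul]; norm_num
  rw [e4] at h1
  rw [e3, map_neg_eq_map, e4] at h2
  have e5 : (1 / 2 * N (w - w')) ^ 2 = N (w - w') ^ 2 / 4 := by ring
  rw [e5] at h1 h2
  linarith

variable {X Y H : Type*} [MeasurableSpace X] [MeasurableSpace Y] [NormedAddCommGroup H]
  [InnerProductSpace ℝ H] [CompleteSpace H] [RKHS ℝ H X ℝ] {c : ℕ} {L κ σ : ℝ}
  {ρ : Measure (X × Y)} {loss : (Fin c → H) → X × Y → ℝ} {r : (Fin c → H) → ℝ}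
  {N : Seminorm ℝ (Fin c → H)} {wstar : Fin c → H}

namespace IsRegularizedProblem

variable (P : IsRegularizedProblem L κ σ ρ loss r N wstar)
include P

lemma excessRisk_nonneg (w : Fin c → H) : 0 ≤ excessRisk ρ loss r wstar w :=
  sub_nonneg.2 (P.isMin w)

lemma abs_loss_sub_le {w w' : Fin c → H} {z : X × Y} {ε : ℝ} (hε : 0 ≤ ε)
    (h : ∀ j, |predictor w z.1 j - predictor w' z.1 j| ≤ ε) :
    |loss w z - loss w' z| ≤ L * ε := by
  refine (P.lipschitz w w' z).trans (mul_le_mul_of_nonneg_left ?_ P.L_pos.le)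
  exact (pi_norm_le_iff_of_nonneg hε).2 fun j => by simpa using h j

lemma abs_loss_sub_le_Btilde (w w' : Fin c → H) (z : X × Y) :
    |loss w z - loss w' z| ≤ L * (Btilde N * N (w - w')) := by
  have hB := Btilde_nonneg P.feature_le P.dominates
  refine P.abs_loss_sub_le (mul_nonneg hB (apply_nonneg _ _)) fun j => ?_
  rw [← predictorFunctional_apply, ← predictorFunctional_apply, ← map_sub]
  exact abs_predictor_le_Btilde_mul P.feature_le P.dominates _ _ _

lemma abs_loss_sub_le_norm (w w' : Fin c → H) (z : X × Y) :
    |loss w z - loss w' z| ≤ L * (‖w - w'‖ * κ) := by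
  refine P.abs_loss_sub_le (mul_nonneg (norm_nonneg _) P.κ_nonneg) fun j => ?_
  rw [← predictorFunctional_apply, ← predictorFunctional_apply, ← map_sub]
  refine (abs_predictor_le P.feature_le _ _ _).trans ?_
  exact mul_le_mul_of_nonneg_right (norm_le_pi_norm (w - w') j) P.κ_nonneg

lemma excessRisk_midpoint : MidpointStronglyConvex N σ (excessRisk ρ loss r wstar) := by
  intro w w'
  have h1 := P.stronglyConvex.midpoint w w'
  have h2 : ∫ z, loss ((1 / 2 : ℝ) • (w + w')) z ∂ρ
      ≤ (∫ z, loss w z ∂ρ + ∫ z, loss w' z ∂ρ) / 2 := by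
    rw [← integral_add (P.integrable_loss w) (P.integrable_loss w'), ← integral_div]
    refine integral_mono (P.integrable_loss _)
      (((P.integrable_loss w).add (P.integrable_loss w')).div_const 2) fun z => ?_
    have := (P.convex_loss z).2 (Set.mem_univ w) (Set.mem_univ w')
      (by norm_num : (0 : ℝ) ≤ 1 / 2) (by norm_num : (0 : ℝ) ≤ 1 / 2) (by norm_num)
    rw [← smul_add] at this
    simp only [smul_eq_mul] at this
    dsimp only
    linarith
  unfold excessRisk regularizedRisk
  linarith

/-- The functionals are the `c` predictions at each of the `2 * n` sample points, so the cover has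
at most `(4 * n * c + 1) ^ (3 * 4 ^ k)` elements. Closeness of all predictions at a point gives
closeness of the loss there, with no loss in `c`. -/
lemma exists_increment_cover {n : ℕ} {Λ : ℝ} (hΛ : 0 < Λ) (p : Fin n → (X × Y) × (X × Y))
    (k : ℕ) : ∃ C : Finset (Fin n → ℝ),
      (C.card : ℝ) ≤ Real.exp (3 * Real.log (4 * (n * c) + 1) * 4 ^ k) ∧
      ∀ w, excessRisk ρ loss r wstar w ≤ Λ → ∃ v ∈ C, ∀ i,
        |v i - ((loss w (p i).2 - loss wstar (p i).2) - (loss w (p i).1 - loss wstar (p i).1))|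
          ≤ 2 * (L * (2 * Btilde N * √(Λ / σ))) / 2 ^ k := by
  classical
  have hB := Btilde_nonneg P.feature_le P.dominates
  let pt : Fin n × Bool → X × Y := fun q => if q.2 then (p q.1).2 else (p q.1).1
  obtain ⟨C, hC, hcov⟩ := exists_finset_cover (ι := (Fin n × Bool) × Fin c)
    (ψ := fun q => predictorFunctional (pt q.1).1 q.2) P.excessRisk_midpoint P.σ_pos
    P.excessRisk_nonneg (w₀ := wstar) (by simp [excessRisk])
    (fun q w => abs_predictor_le_Btilde_mul P.feature_le P.dominates w (pt q.1).1 q.2) hB hΛ k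
  refine ⟨C.image fun v i =>
    (loss v (p i).2 - loss wstar (p i).2) - (loss v (p i).1 - loss wstar (p i).1), ?_, ?_⟩
  · have h1 : ((C.card : ℕ) : ℝ) ≤ (4 * (n * c) + 1 : ℝ) ^ (3 * 4 ^ k) := by
      have h2 : (C.card : ℝ) ≤ ((2 * Fintype.card ((Fin n × Bool) × Fin c) + 1 : ℕ) : ℝ)
          ^ (3 * 4 ^ k) := by exact_mod_cast hC
      refine h2.trans_eq ?_
      congr 1
      simp only [Fintype.card_prod, Fintype.card_fin, Fintype.card_bool]
      push_cast
      ring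
    have h3 : (C.image fun v i => (loss v (p i).2 - loss wstar (p i).2) -
        (loss v (p i).1 - loss wstar (p i).1) : Finset (Fin n → ℝ)).card ≤ C.card :=
      Finset.card_image_le
    refine (Nat.cast_le.2 h3).trans (h1.trans_eq ?_)
    have h4 : (0 : ℝ) < 4 * (n * c) + 1 := by positivity
    rw [← Real.rpow_natCast, Real.rpow_def_of_pos h4]
    congr 1
    push_cast
    ring
  · intro w hw
    obtain ⟨v, hv, hvw⟩ := hcov w hw
    refine ⟨_, Finset.mem_image_of_mem _ hv, fun i => ?_⟩
    set ε : ℝ := 2 * Btilde N * √(Λ / σ) / 2 ^ k with hε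
    have hε0 : 0 ≤ ε := by positivity
    have h1 : |loss v (p i).1 - loss w (p i).1| ≤ L * ε :=
      P.abs_loss_sub_le hε0 fun j => by simpa [pt] using hvw ((i, false), j)
    have h2 : |loss v (p i).2 - loss w (p i).2| ≤ L * ε :=
      P.abs_loss_sub_le hε0 fun j => by simpa [pt] using hvw ((i, true), j)
    have h3 := abs_sub (loss v (p i).2 - loss w (p i).2) (loss v (p i).1 - loss w (p i).1)
    have h4 : 2 * (L * (2 * Btilde N * √(Λ / σ))) / 2 ^ k = L * ε + L * ε := by
      rw [hε]; ring
    rw [h4]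
    refine le_trans (le_of_eq ?_) (h3.trans (add_le_add h2 h1))
    congr 1
    ring

/-- Uniform deviation over a sublevel set of the excess risk, with explicit constants. -/
lemma exists_deviation_event [IsProbabilityMeasure ρ] [TopologicalSpace.SeparableSpace H] {n : ℕ}
    (hn : 0 < n) {Λ δ : ℝ} (hΛ : 0 < Λ) (hδ : 0 < δ) (hδ1 : δ ≤ 1) {K : ℕ} (hK : 0 < K)
    (hK2 : √(n : ℝ) ≤ 2 ^ K) :
    ∃ G : Set (Fin n → X × Y), MeasurableSet G ∧
      Measure.pi (fun _ : Fin n => ρ) Gᶜ ≤ ENNReal.ofReal δ ∧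
      ∀ S ∈ G, ∀ w, excessRisk ρ loss r wstar w ≤ Λ →
        n * (excessRisk ρ loss r wstar w
            - (empiricalRisk loss r S w - empiricalRisk loss r S wstar))
          ≤ 4 * (L * (2 * Btilde N * √(Λ / σ))) * √(n : ℝ) *
            (1 + 8 * K * √(3 * Real.log (4 * (n * c) + 1)) + 8 * √(Real.log (2 * K / δ))) := by
  have hB := Btilde_nonneg P.feature_le P.dominates
  have hL := P.L_pos.le
  set Q : ℝ := 4 * (L * (2 * Btilde N * √(Λ / σ))) * √(n : ℝ) *
    (1 + 8 * K * √(3 * Real.log (4 * (n * c) + 1)) + 8 * √(Real.log (2 * K / δ))) with hQ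
  let T₀ : Set (Fin c → H) := {w | excessRisk ρ loss r wstar w ≤ Λ}
  -- The dense subset is taken for the product Hilbert norm, not for `N`, which need not be
  -- continuous in that topology.
  obtain ⟨T, hTT, hTc, hTd⟩ :=
    (TopologicalSpace.IsSeparable.of_separableSpace T₀).exists_countable_dense_subset
  let f : (Fin c → H) → X × Y → ℝ := fun w z => loss w z - loss wstar z
  have hf : ∀ w, Measurable (f w) := fun w => (P.measurable_loss w).sub (P.measurable_loss wstar)
  have hfi : ∀ w, Integrable (f w) ρ := fun w =>
    (P.integrable_loss w).sub (P.integrable_loss wstar)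
  have hdev : ∀ S : Fin n → X × Y, ∀ w, n * (excessRisk ρ loss r wstar w
      - (empiricalRisk loss r S w - empiricalRisk loss r S wstar))
      = n * ∫ z, f w z ∂ρ - ∑ i, f w (S i) := by
    intro S w
    have hn0 : (n : ℝ) ≠ 0 := by exact_mod_cast hn.ne'
    simp only [f]
    rw [integral_sub (P.integrable_loss w) (P.integrable_loss wstar), Finset.sum_sub_distrib]
    unfold excessRisk regularizedRisk empiricalRisk
    field_simp
    ring
  have hprob := measure_exists_deviation_lt_le (ι := Fin n) (ρ := ρ) hTc hf
    (b := L * (2 * Btilde N * √(Λ / σ))) (A := 3 * Real.log (4 * (n * c) + 1)) (δ := δ) (K := K)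
    (by positivity)
    (fun w hw z => (P.abs_loss_sub_le_Btilde w wstar z).trans (by
      refine mul_le_mul_of_nonneg_left ?_ hL
      have := P.excessRisk_midpoint.le_of_le P.σ_pos P.excessRisk_nonneg
        (w₀ := wstar) (by simp [excessRisk]) (hTT hw)
      calc Btilde N * N (w - wstar) ≤ Btilde N * (2 * √(Λ / σ)) := by gcongr
        _ = _ := by ring))
    (mul_nonneg (by norm_num) (Real.log_nonneg (le_add_of_nonneg_left (by positivity)))) hδ hδ1
    (by simpa using hn) hK (by simpa using hK2)
    (fun p k => by
      obtain ⟨C, h1, h2⟩ := P.exists_increment_cover hΛ p k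
      exact ⟨C, h1, fun w hw => h2 w (hTT hw)⟩)
  rw [Fintype.card_fin, ← hQ] at hprob
  have hGm : MeasurableSet {S : Fin n → X × Y | ∃ w ∈ T,
      Q < n * ∫ z, f w z ∂ρ - ∑ i, f w (S i)} := by
    have : {S : Fin n → X × Y | ∃ w ∈ T, Q < n * ∫ z, f w z ∂ρ - ∑ i, f w (S i)}
        = ⋃ w ∈ T, {S : Fin n → X × Y | Q < n * ∫ z, f w z ∂ρ - ∑ i, f w (S i)} := by
      ext p; simp
    rw [this]
    refine MeasurableSet.biUnion hTc fun w _ => measurableSet_lt measurable_const ?_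
    have := hf w
    fun_prop
  refine ⟨_, hGm.compl, by rwa [compl_compl], fun S hS w hw => ?_⟩
  rw [hdev]
  -- Empirical and expected losses are both `L * κ`-Lipschitz in the product norm, so the bound
  -- passes from `T` to its closure. The regularizer, whose continuity is not assumed, does not
  -- appear.
  have hclosed : IsClosed {w | n * ∫ z, f w z ∂ρ - ∑ i, f w (S i) ≤ Q} := by
    have hcont : ∀ z, Continuous fun w => f w z := by
      intro z
      refine (LipschitzWith.of_dist_le_mul (K := (L * κ).toNNReal) fun w w' => ?_).continuous
      rw [Real.dist_eq, dist_eq_norm, Real.coe_toNNReal _ (mul_nonneg hL P.κ_nonneg)]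
      simp only [f, sub_sub_sub_cancel_right]
      refine (P.abs_loss_sub_le_norm w w' z).trans_eq (by ring)
    have hcint : Continuous fun w => ∫ z, f w z ∂ρ := by
      refine (LipschitzWith.of_dist_le_mul (K := (L * κ).toNNReal) fun w w' => ?_).continuous
      rw [Real.dist_eq, dist_eq_norm, Real.coe_toNNReal _ (mul_nonneg hL P.κ_nonneg),
        ← integral_sub (hfi w) (hfi w'), ← Real.norm_eq_abs]
      refine (norm_integral_le_of_norm_le_const (C := L * κ * ‖w - w'‖)
        (.of_forall fun z => ?_)).trans_eq (by simp)
      simp only [f, sub_sub_sub_cancel_right, Real.norm_eq_abs]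
      refine (P.abs_loss_sub_le_norm w w' z).trans_eq (by ring)
    refine isClosed_le ?_ continuous_const
    have := fun i => hcont (S i)
    fun_prop
  refine hclosed.closure_subset_iff.2 (fun v hv => ?_) (hTd hw)
  by_contra hlt
  exact hS ⟨v, hv, not_le.1 hlt⟩

end IsRegularizedProblem

end Deviation


/-! ### Choice of the number of scales and elementary inequalities. -/

section Numerics

/-- With `K = Nat.log 2 n + 1`, both `K` and the entropy root are `O(1 + log (nc))`; their product
gives the square. -/
lemma exists_levels_bound {n c : ℕ} (hn : 0 < n) (hc : 0 < c) {δ : ℝ} (hδ : 0 < δ) (hδ1 : δ ≤ 1) :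
    ∃ K : ℕ, 0 < K ∧ √(n : ℝ) ≤ 2 ^ K ∧
      1 + 8 * K * √(3 * Real.log (4 * (n * c) + 1)) + 8 * √(Real.log (2 * K / δ))
        ≤ 65 * (1 + Real.log (n * c)) ^ 2 * (1 + √(Real.log (1 / δ))) := by
  have hn1 : (1 : ℝ) ≤ n := by exact_mod_cast hn
  have hc1 : (1 : ℝ) ≤ c := by exact_mod_cast hc
  have hnc : (1 : ℝ) ≤ n * c := one_le_mul_of_one_le_of_one_le hn1 hc1
  set x : ℝ := 1 + Real.log (n * c) with hx
  have hx1 : 1 ≤ x := by linarith [Real.log_nonneg hnc]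
  have hs : 0 ≤ √(Real.log (1 / δ)) := Real.sqrt_nonneg _
  have hlog2 := Real.log_two_gt_d9
  refine ⟨Nat.log 2 n + 1, Nat.succ_pos _, ?_, ?_⟩
  · have h1 : (n : ℝ) < 2 ^ (Nat.log 2 n + 1) := by
      exact_mod_cast Nat.lt_pow_succ_log_self (by norm_num) n
    have h2 : √(n : ℝ) ≤ n := by
      rw [Real.sqrt_le_left (by linarith)]
      nlinarith
    linarith
  · set K : ℝ := ((Nat.log 2 n + 1 : ℕ) : ℝ) with hK
    have hK1 : 1 ≤ K := by rw [hK]; exact_mod_cast Nat.succ_le_succ (Nat.zero_le _)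
    have hKx : K ≤ 2 * x := by
      have h1 : (2 : ℝ) ^ Nat.log 2 n ≤ n := by exact_mod_cast Nat.pow_log_le_self 2 hn.ne'
      have h2 := Real.log_le_log (by positivity) h1
      rw [Real.log_pow] at h2
      have h3 : Real.log n ≤ Real.log (n * c) :=
        Real.log_le_log (by linarith) (le_mul_of_one_le_right (by linarith) hc1)
      have h4 : (0 : ℝ) ≤ (Nat.log 2 n : ℝ) := Nat.cast_nonneg _
      rw [hK]
      push_cast
      nlinarith
    have hA : √(3 * Real.log (4 * (n * c) + 1)) ≤ 3 * x := by
      apply Real.sqrt_le_iff.2 ⟨by linarith, ?_⟩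
      have h1 : Real.log (4 * (n * c) + 1) ≤ Real.log 8 + Real.log (n * c) := by
        rw [← Real.log_mul (by norm_num) (by linarith)]
        exact Real.log_le_log (by linarith) (by linarith)
      have h2 : Real.log 8 = 3 * Real.log 2 := by
        rw [show (8 : ℝ) = 2 ^ 3 by norm_num, Real.log_pow]; norm_num
      have h3 := Real.log_two_lt_d9
      nlinarith
    have hl : √(Real.log (2 * K / δ)) ≤ 2 * x + √(Real.log (1 / δ)) := by
      have h1 : Real.log (2 * K / δ) = Real.log (2 * K) + Real.log (1 / δ) := by
        rw [← Real.log_mul (by positivity) (by positivity)]; congr 1; ring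
      have h2 : Real.log (2 * K) ≤ (2 * x) ^ 2 := by
        have := Real.log_le_sub_one_of_pos (show 0 < 2 * K by positivity)
        nlinarith
      rw [h1]
      apply Real.sqrt_le_iff.2 ⟨by linarith, ?_⟩
      have h3 : 0 ≤ Real.log (1 / δ) := Real.log_nonneg (by rwa [le_div_iff₀ hδ, one_mul])
      have h4 := Real.sq_sqrt h3
      nlinarith
    have h1 : K * √(3 * Real.log (4 * (n * c) + 1)) ≤ 2 * x * (3 * x) :=
      mul_le_mul hKx hA (Real.sqrt_nonneg _) (by linarith)
    nlinarith [mul_nonneg hs (by nlinarith : 0 ≤ x ^ 2 - 1)]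

/-- Converts the natural factor `B̃ (1 + √log(1/δ))` into the stated `log(1/δ) + B̃`, using `B̃ ≤
κ`; this is the source of the dependence of the constant on `κ`. -/
lemma sq_mul_one_add_sqrt_le {κ B l : ℝ} (hB : 0 ≤ B) (hBκ : B ≤ κ) (hl : 0 ≤ l) :
    (B * (1 + √l)) ^ 2 ≤ 2 * (κ + κ ^ 2) * (l + B) := by
  have hκ : 0 ≤ κ := hB.trans hBκ
  have h1 := Real.sq_sqrt hl
  have h2 : (1 + √l) ^ 2 ≤ 2 * (1 + l) := by nlinarith [sq_nonneg (1 - √l)]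
  calc (B * (1 + √l)) ^ 2 = B ^ 2 * (1 + √l) ^ 2 := by ring
    _ ≤ B ^ 2 * (2 * (1 + l)) := by gcongr
    _ = 2 * (B * B + B ^ 2 * l) := by ring
    _ ≤ 2 * (κ * B + κ ^ 2 * l) := by gcongr
    _ ≤ 2 * (κ + κ ^ 2) * (l + B) := by
        nlinarith [mul_nonneg hκ hl, mul_nonneg (sq_nonneg κ) hB]

/-- Telescoping weights that distribute `δ` over the peeling levels. -/
lemma sum_range_one_div_mul_le (N : ℕ) {δ : ℝ} (hδ : 0 ≤ δ) :
    ∑ j ∈ Finset.range N, δ / ((j + 1 : ℝ) * (j + 2)) ≤ δ := by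
  have h : ∑ j ∈ Finset.range N, δ / ((j + 1 : ℝ) * (j + 2)) = δ * (1 - 1 / (N + 1)) := by
    induction N with
    | zero => simp
    | succ N ih =>
      rw [Finset.sum_range_succ, ih]
      push_cast
      field_simp
      ring
  rw [h]
  have : (0 : ℝ) ≤ 1 / (N + 1) := by positivity
  nlinarith

end Numerics

lemma HoldsWithProb.of_compl_le {Ω : Type*} [MeasurableSpace Ω] {μ : Measure Ω}
    [IsProbabilityMeasure μ] {δ : ℝ} {P : Ω → Prop} {G : Set Ω} (hG : MeasurableSet G)
    (hδ : 0 ≤ δ) (hμ : μ Gᶜ ≤ ENNReal.ofReal δ) (hP : ∀ S ∈ G, P S) : HoldsWithProb μ δ P := by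
  refine ⟨G, hG, ?_, hP⟩
  rw [ENNReal.ofReal_sub _ hδ, ENNReal.ofReal_one, tsub_le_iff_right]
  rw [← prob_add_prob_compl (μ := μ) hG]
  gcongr

lemma IsStronglyConvex.convexOn {H : Type*} [NormedAddCommGroup H] [InnerProductSpace ℝ H] {c : ℕ}
    {N : Seminorm ℝ (Fin c → H)} {σ : ℝ} (hσ : 0 ≤ σ) {r : (Fin c → H) → ℝ}
    (hr : IsStronglyConvex N σ r) : ConvexOn ℝ Set.univ r := by
  refine ⟨convex_univ, fun w _ w' _ a b ha hb hab => ?_⟩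
  obtain ⟨g, hg⟩ := hr (a • w + b • w')
  have h1 := hg w
  have h2 := hg w'
  have e1 : w - (a • w + b • w') = b • (w - w') := by
    have : a = 1 - b := by linarith
    subst this; module
  have e2 : w' - (a • w + b • w') = -(a • (w - w')) := by
    have : a = 1 - b := by linarith
    subst this; module
  have e3 : innerProd (b • (w - w')) g = b * innerProd (w - w') g := by
    simp [innerProd, inner_smul_left, Finset.mul_sum]
  have e4 : innerProd (-(a • (w - w'))) g = -(a * innerProd (w - w') g) := by
    simp [innerProd, inner_smul_left, Finset.mul_sum]
  rw [e1, e3] at h1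
  rw [e2, e4] at h2
  have h3 : 0 ≤ σ / 2 * N (b • (w - w')) ^ 2 := by positivity
  have h4 : 0 ≤ σ / 2 * N (-(a • (w - w'))) ^ 2 := by positivity
  have h5 : r (a • w + b • w') + b * innerProd (w - w') g ≤ r w := by linarith
  have h6 : r (a • w + b • w') - a * innerProd (w - w') g ≤ r w' := by linarith
  have h7 := mul_le_mul_of_nonneg_left h5 ha
  have h8 := mul_le_mul_of_nonneg_left h6 hb
  simp only [smul_eq_mul]
  have h9 : r (a • w + b • w') = (a + b) * r (a • w + b • w') := by rw [hab, one_mul]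
  linarith

/-! ### Localization for empirical minimizers and peeling for all hypotheses. -/

namespace IsRegularizedProblem

variable {X Y H : Type*} [MeasurableSpace X] [MeasurableSpace Y] [NormedAddCommGroup H]
  [InnerProductSpace ℝ H] [CompleteSpace H] [RKHS ℝ H X ℝ] {c : ℕ} {L κ σ : ℝ}
  {ρ : Measure (X × Y)} {loss : (Fin c → H) → X × Y → ℝ} {r : (Fin c → H) → ℝ}
  {N : Seminorm ℝ (Fin c → H)} {wstar : Fin c → H}
  (P : IsRegularizedProblem L κ σ ρ loss r N wstar)
include P

lemma convexOn_excessRisk : ConvexOn ℝ Set.univ (excessRisk ρ loss r wstar) := by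
  have hr := P.stronglyConvex.convexOn P.σ_pos.le
  refine ⟨convex_univ, fun w _ w' _ a b ha hb hab => ?_⟩
  have h1 := hr.2 (Set.mem_univ w) (Set.mem_univ w') ha hb hab
  have h2 : ∫ z, loss (a • w + b • w') z ∂ρ ≤ a * ∫ z, loss w z ∂ρ + b * ∫ z, loss w' z ∂ρ := by
    rw [← integral_const_mul, ← integral_const_mul,
      ← integral_add ((P.integrable_loss w).const_mul a) ((P.integrable_loss w').const_mul b)]
    exact integral_mono (P.integrable_loss _)
      (((P.integrable_loss w).const_mul a).add ((P.integrable_loss w').const_mul b)) fun z =>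
      (P.convex_loss z).2 (Set.mem_univ w) (Set.mem_univ w') ha hb hab
  simp only [smul_eq_mul] at h1 ⊢
  have h3 : a * regularizedRisk ρ loss r wstar + b * regularizedRisk ρ loss r wstar
      = regularizedRisk ρ loss r wstar := by rw [← add_mul, hab, one_mul]
  unfold excessRisk
  unfold regularizedRisk at h3 ⊢
  linarith

lemma convexOn_empiricalRisk {n : ℕ} (S : Fin n → X × Y) :
    ConvexOn ℝ Set.univ (empiricalRisk loss r S) := by
  refine ConvexOn.add ?_ (P.stronglyConvex.convexOn P.σ_pos.le)
  refine ConvexOn.smul (c := 1 / (n : ℝ)) (by positivity) ?_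
  refine ⟨convex_univ, fun w hw w' hw' a b ha hb hab => ?_⟩
  rw [Finset.smul_sum, Finset.smul_sum, ← Finset.sum_add_distrib]
  exact Finset.sum_le_sum fun i _ => (P.convex_loss (S i)).2 hw hw' ha hb hab

variable [IsProbabilityMeasure ρ] [TopologicalSpace.SeparableSpace H] {n : ℕ}

/-- Uniform deviation over a sublevel set of the excess risk. -/
lemma exists_deviation_event_le_sqrt (hn : 0 < n) (hc : 0 < c) {Λ δ : ℝ} (hΛ : 0 < Λ)
    (hδ : 0 < δ) (hδ1 : δ ≤ 1) :
    ∃ G : Set (Fin n → X × Y), MeasurableSet G ∧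
      Measure.pi (fun _ : Fin n => ρ) Gᶜ ≤ ENNReal.ofReal δ ∧
      ∀ S ∈ G, ∀ w, excessRisk ρ loss r wstar w ≤ Λ →
        excessRisk ρ loss r wstar w - (empiricalRisk loss r S w - empiricalRisk loss r S wstar)
          ≤ 520 * L * (1 + Real.log (n * c)) ^ 2 * (Btilde N * (1 + √(Real.log (1 / δ)))) *
            √(Λ / (n * σ)) := by
  obtain ⟨K, hK, hK2, hKb⟩ := exists_levels_bound hn hc hδ hδ1
  obtain ⟨G, hG, hGμ, hdev⟩ := P.exists_deviation_event hn hΛ hδ hδ1 hK hK2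
  refine ⟨G, hG, hGμ, fun S hS w hw => ?_⟩
  have hB := Btilde_nonneg P.feature_le P.dominates
  have hL := P.L_pos.le
  have hn0 : (0 : ℝ) < n := by exact_mod_cast hn
  have hsn : 0 < √(n : ℝ) := Real.sqrt_pos.2 hn0
  have h1 := hdev S hS w hw
  have h2 : √(Λ / (n * σ)) = √(Λ / σ) / √(n : ℝ) := by
    rw [← Real.sqrt_div' _ hn0.le, div_div, mul_comm σ]
  have h3 := h1.trans (mul_le_mul_of_nonneg_left hKb
    (show 0 ≤ 4 * (L * (2 * Btilde N * √(Λ / σ))) * √(n : ℝ) by positivity))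
  rw [h2, ← mul_le_mul_iff_right₀ hn0]
  refine h3.trans_eq ?_
  field_simp
  rw [Real.sq_sqrt hn0.le]
  ring

/-- Localization at one level `Λ` with `a * √(Λ / (n * σ)) < Λ`. This avoids peeling and its extra
logarithm. -/
lemma exists_event_minimizer_le (hn : 0 < n) (hc : 0 < c) {δ : ℝ} (hδ : 0 < δ) (hδ1 : δ ≤ 1) :
    ∃ G : Set (Fin n → X × Y), MeasurableSet G ∧
      Measure.pi (fun _ : Fin n => ρ) Gᶜ ≤ ENNReal.ofReal δ ∧
      ∀ S ∈ G, ∀ wS, (∀ w, empiricalRisk loss r S wS ≤ empiricalRisk loss r S w) →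
        excessRisk ρ loss r wstar wS
          ≤ 4 * (520 * L * (1 + Real.log (n * c)) ^ 2 *
              (Btilde N * (1 + √(Real.log (1 / δ))))) ^ 2 / (n * σ) := by
  set a : ℝ := 520 * L * (1 + Real.log (n * c)) ^ 2 * (Btilde N * (1 + √(Real.log (1 / δ))))
    with ha
  have hB := Btilde_nonneg P.feature_le P.dominates
  have hL := P.L_pos.le
  have ha0 : 0 ≤ a := by positivity
  have hn0 : (0 : ℝ) < n := by exact_mod_cast hn
  have hnσ : 0 < n * σ := mul_pos hn0 P.σ_pos
  -- For `a > 0`, `Λ = 4 * a ^ 2 / (n * σ)` makes the deviation equal to `Λ / 2`; for `a = 0` any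
  -- positive level works.
  obtain ⟨Λ, hΛ, hlt, hle⟩ : ∃ Λ : ℝ, 0 < Λ ∧ a * √(Λ / (n * σ)) < Λ ∧
      a * √(Λ / (n * σ)) ≤ 4 * a ^ 2 / (n * σ) := by
    rcases ha0.eq_or_lt with h | h
    · exact ⟨1, one_pos, by simp [← h], by simp [← h]⟩
    · have h1 : √(4 * a ^ 2 / (n * σ) / (n * σ)) = 2 * a / (n * σ) := by
        rw [show 4 * a ^ 2 / (n * σ) / (n * σ) = (2 * a / (n * σ)) ^ 2 by ring,
          Real.sqrt_sq (by positivity)]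
      have h2 : 4 * a ^ 2 / (n * σ) = a * (2 * a / (n * σ)) + 2 * a ^ 2 / (n * σ) := by ring
      have h3 : 0 < 2 * a ^ 2 / (n * σ) := by positivity
      refine ⟨4 * a ^ 2 / (n * σ), by positivity, ?_, ?_⟩ <;> rw [h1] <;> linarith
  obtain ⟨G, hG, hGμ, hdev⟩ := P.exists_deviation_event_le_sqrt hn hc hΛ hδ hδ1
  refine ⟨G, hG, hGμ, fun S hS wS hwS => ?_⟩
  have hin : excessRisk ρ loss r wstar wS ≤ Λ := by
    by_contra hgt
    push Not at hgt
    -- On the segment from `wstar` to `wS` the excess risk is a convex function on the line, hence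
    -- continuous, and takes the value `Λ`. There the empirical risk is at most that of `wstar`, so
    -- the deviation is at least `Λ`, which is impossible on `G`.
    let g : ℝ → ℝ := excessRisk ρ loss r wstar ∘ AffineMap.lineMap wstar wS
    have hg : ConvexOn ℝ Set.univ g := by
      have := P.convexOn_excessRisk.comp_affineMap (AffineMap.lineMap wstar wS : ℝ →ᵃ[ℝ] Fin c → H)
      rwa [Set.preimage_univ] at this
    have hgc : ContinuousOn g (Set.Icc 0 1) :=
      (hg.continuousOn isOpen_univ).mono (Set.subset_univ _)
    have hg0 : g 0 = 0 := by simp [g, excessRisk]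
    have hg1 : g 1 = excessRisk ρ loss r wstar wS := by simp [g]
    obtain ⟨t, ht, hgt'⟩ := intermediate_value_Icc zero_le_one hgc
      (show Λ ∈ Set.Icc (g 0) (g 1) by rw [hg0, hg1]; exact ⟨hΛ.le, hgt.le⟩)
    have hemp : empiricalRisk loss r S (AffineMap.lineMap wstar wS t)
        ≤ empiricalRisk loss r S wstar := by
      have h1 := (P.convexOn_empiricalRisk S).2 (Set.mem_univ wstar) (Set.mem_univ wS)
        (sub_nonneg.2 ht.2) ht.1 (by ring)
      rw [← AffineMap.lineMap_apply_module] at h1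
      simp only [smul_eq_mul] at h1
      nlinarith [hwS wstar, ht.1]
    have h2 := hdev S hS (AffineMap.lineMap wstar wS t) hgt'.le
    have h3 : excessRisk ρ loss r wstar (AffineMap.lineMap wstar wS t) = Λ := hgt'
    linarith
  have h1 := hdev S hS wS hin
  have h2 := hwS wstar
  linarith

/-- Peeling over dyadic levels of the excess risk above `1 / (n * σ)`. A level index is at most a
multiple of `log (n * σ * Δ)`, so the extra confidence cost is logarithmic and is absorbed by one
more power. -/
lemma exists_event_uniform (hn : 0 < n) (hc : 0 < c) {δ : ℝ} (hδ : 0 < δ) (hδ1 : δ ≤ 1) :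
    ∃ G : Set (Fin n → X × Y), MeasurableSet G ∧
      Measure.pi (fun _ : Fin n => ρ) Gᶜ ≤ ENNReal.ofReal δ ∧
      ∀ S ∈ G, ∀ w, 1 / (n * σ) < excessRisk ρ loss r wstar w →
        excessRisk ρ loss r wstar w - (empiricalRisk loss r S w - empiricalRisk loss r S wstar)
          ≤ 3120 * L * (1 + Real.log (n * c)
              + Real.log (n * σ * excessRisk ρ loss r wstar w)) ^ 3 *
            (Btilde N * (1 + √(Real.log (1 / δ)))) *
            √(excessRisk ρ loss r wstar w / (n * σ)) := by
  have hB := Btilde_nonneg P.feature_le P.dominates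
  have hL := P.L_pos.le
  have hn0 : (0 : ℝ) < n := by exact_mod_cast hn
  have hnc : (1 : ℝ) ≤ n * c := by exact_mod_cast Nat.mul_pos hn hc
  have hnσ : 0 < n * σ := mul_pos hn0 P.σ_pos
  have hδj : ∀ j : ℕ, 0 < δ / ((j + 1 : ℝ) * (j + 2)) := fun j => by positivity
  have hδj1 : ∀ j : ℕ, δ / ((j + 1 : ℝ) * (j + 2)) ≤ 1 := fun j => by
    rw [div_le_one (by positivity)]
    have : (0 : ℝ) ≤ j := Nat.cast_nonneg j
    nlinarith
  choose G hG hGμ hdev using fun j : ℕ => P.exists_deviation_event_le_sqrt (n := n) hn hc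
    (Λ := 2 ^ (j + 1) / (n * σ)) (by positivity) (hδj j) (hδj1 j)
  refine ⟨⋂ j, G j, MeasurableSet.iInter hG, ?_, fun S hS w hw => ?_⟩
  · rw [Set.compl_iInter]
    refine (measure_iUnion_le _).trans ((ENNReal.tsum_le_tsum hGμ).trans ?_)
    refine ENNReal.tsum_le_of_sum_range_le fun M => ?_
    rw [← ENNReal.ofReal_sum_of_nonneg fun j _ => (hδj j).le]
    exact ENNReal.ofReal_le_ofReal (sum_range_one_div_mul_le M hδ.le)
  · set D := excessRisk ρ loss r wstar w with hD
    have hy : 1 < n * σ * D := by rwa [div_lt_iff₀' hnσ] at hw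
    -- The level `j` satisfies `2 ^ j ≤ n * σ * D < 2 ^ (j + 1)`, so replacing `Λ` by `D` costs only
    -- a constant factor.
    obtain ⟨j, hj1, hj2⟩ := exists_nat_pow_near hy.le (one_lt_two : (1 : ℝ) < 2)
    have hDΛ : D ≤ 2 ^ (j + 1) / (n * σ) := by
      rw [le_div_iff₀ hnσ]; linarith
    have h1 := hdev j S (Set.mem_iInter.1 hS j) w hDΛ
    set q := Real.log (n * σ * D) with hq
    have hq0 : 0 ≤ q := Real.log_nonneg hy.le
    have hjq : (j : ℝ) ≤ 2 * q := by
      have h2 := Real.log_le_log (by positivity) hj1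
      rw [Real.log_pow] at h2
      have := Real.log_two_gt_d9
      have h3 : (0 : ℝ) ≤ j := Nat.cast_nonneg j
      nlinarith
    set s := √(Real.log (1 / δ)) with hs
    have hs0 : 0 ≤ s := Real.sqrt_nonneg _
    have hl0 : 0 ≤ Real.log (1 / δ) := Real.log_nonneg (by rwa [le_div_iff₀ hδ, one_mul])
    have hncl := Real.log_nonneg hnc
    set x := 1 + Real.log (n * c) + q with hx
    have hx1 : 1 ≤ x := by linarith
    have hlog : √(Real.log (1 / (δ / ((j + 1 : ℝ) * (j + 2))))) ≤ s + 2 * x := by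
      have e1 : 1 / (δ / ((j + 1 : ℝ) * (j + 2))) = 1 / δ * ((j + 1) * (j + 2)) := by
        field_simp
      rw [e1, Real.log_mul (by positivity) (by positivity),
        Real.log_mul (by positivity) (by positivity)]
      have e2 := Real.log_le_sub_one_of_pos (show (0 : ℝ) < j + 1 by positivity)
      have e3 := Real.log_le_sub_one_of_pos (show (0 : ℝ) < j + 2 by positivity)
      apply Real.sqrt_le_iff.2 ⟨by linarith, ?_⟩
      have e4 := Real.sq_sqrt hl0
      nlinarith [mul_nonneg hs0 (by linarith : 0 ≤ x)]
    have hsqrt : √(2 ^ (j + 1) / (n * σ) / (n * σ)) ≤ 2 * √(D / (n * σ)) := by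
      have e1 : (2 : ℝ) * √(D / (n * σ)) = √(4 * (D / (n * σ))) := by
        rw [Real.sqrt_mul (by norm_num), show (4 : ℝ) = 2 ^ 2 by norm_num,
          Real.sqrt_sq (by norm_num)]
      rw [e1]
      apply Real.sqrt_le_sqrt
      have e2 : (2 : ℝ) ^ (j + 1) / (n * σ) ≤ 4 * D := by
        rw [div_le_iff₀ hnσ, pow_succ]
        nlinarith
      calc (2 : ℝ) ^ (j + 1) / (n * σ) / (n * σ) ≤ 4 * D / (n * σ) := by gcongr
        _ = _ := by ring
    have hfac : 1 + √(Real.log (1 / (δ / ((j + 1 : ℝ) * (j + 2))))) ≤ 3 * x * (1 + s) := by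
      nlinarith [mul_nonneg hs0 (by linarith : 0 ≤ x - 1)]
    calc _ ≤ _ := h1
      _ ≤ 520 * L * x ^ 2 * (Btilde N * (3 * x * (1 + s))) * (2 * √(D / (n * σ))) := by
        gcongr
        linarith
      _ = _ := by ring

end IsRegularizedProblem

end VectorValuedLearning

end

/-! ### The main theorem. -/

open VectorValuedLearning in
theorem theorem2 :
    -- the polylogarithmic order `p` is absolute; the constant `C` depends only on `L` and `κ`
    ∃ p : ℕ, ∀ L κ : ℝ, 0 < L → 0 ≤ κ → ∃ C : ℝ, 0 < C ∧
      ∀ (d : ℕ) (X : Set (EuclideanSpace ℝ (Fin d)))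
        (Y : Type*) [MeasurableSpace Y]
        (H : Type*) [NormedAddCommGroup H] [InnerProductSpace ℝ H] [CompleteSpace H]
        [RKHS ℝ H X ℝ]
        (c n : ℕ) (ρ : Measure (X × Y)) [IsProbabilityMeasure ρ]
        (loss : (Fin c → H) → X × Y → ℝ) (r : (Fin c → H) → ℝ)
        (N : Seminorm ℝ (Fin c → H)) (σ δ : ℝ) (wstar : Fin c → H),
        0 < c → 0 < n → 0 < σ → 0 < δ → δ < 1 →
        -- Mercer kernel, bounded feature map
        Continuous (fun q : X × X => kernelFun H q.1 q.2) →
        (∀ x : X, ‖featureMap H x‖ ≤ κ) →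
        -- the loss and the regularizer are nonnegative; the loss has finite expectation
        (∀ w z, 0 ≤ loss w z) → (∀ w, 0 ≤ r w) →
        (∀ w, Measurable (loss w)) → (∀ w, Integrable (loss w) ρ) →
        -- Lipschitz continuity and (strong) convexity
        IsLipschitzLoss L loss →
        (∀ z, ConvexOn ℝ Set.univ (fun w => loss w z)) →
        DominatesTwoInfty N → IsStronglyConvex N σ r →
        -- `wstar` minimizes the regularized risk
        (∀ w, regularizedRisk ρ loss r wstar ≤ regularizedRisk ρ loss r w) →
        -- uniform bound over all `w`
        HoldsWithProb (Measure.pi (fun _ : Fin n => ρ)) δ (fun S =>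
          ∀ w : Fin c → H,
            regularizedRisk ρ loss r w - regularizedRisk ρ loss r wstar ≤
              max (empiricalRisk loss r S w - empiricalRisk loss r S wstar) (1 / (n * σ)) +
              C * (1 + Real.log (n * c) + Real.log (max 1 (n * σ *
                  (regularizedRisk ρ loss r w - regularizedRisk ρ loss r wstar)))) ^ p *
                Real.sqrt ((regularizedRisk ρ loss r w - regularizedRisk ρ loss r wstar) *
                  (Real.log (1 / δ) + Btilde N) / (n * σ))) ∧
        -- bound for the minimizer of the regularized empirical risk
        HoldsWithProb (Measure.pi (fun _ : Fin n => ρ)) δ (fun S =>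
          ∀ wS : Fin c → H, (∀ w, empiricalRisk loss r S wS ≤ empiricalRisk loss r S w) →
            regularizedRisk ρ loss r wS - regularizedRisk ρ loss r wstar ≤
              C * (1 + Real.log (n * c)) ^ p *
                ((Real.log (1 / δ) + Btilde N) / (n * σ))) := by
  -- The power `4` comes from squaring the `(1 + log (nc)) ^ 2` deviation factor for the minimizer;
  -- the uniform bound needs only `3`. The first summand of the constant serves the uniform bound,
  -- the second the minimizer, and `1` ensures positivity.
  refine ⟨4, fun L κ hL hκ0 => ⟨3120 * L * √(2 * (κ + κ ^ 2))
    + 8 * (520 * L) ^ 2 * (κ + κ ^ 2) + 1, by positivity, ?_⟩⟩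
  intro d X Y _ H _ _ _ _ c n ρ _ loss r N σ δ wstar hc hn hσ hδ hδ1 hK hκ _ _ hmeas hint hlip
    hconv hdom hsc hmin
  have P : IsRegularizedProblem L κ σ ρ loss r N wstar :=
    ⟨hL, hκ0, hσ, hκ, hmeas, hint, hlip, hconv, hdom, hsc, hmin⟩
  have hsep : TopologicalSpace.SeparableSpace H := separableSpace_of_continuous_kernel hK
  have hB := Btilde_nonneg hκ hdom
  have hBκ := Btilde_le hκ0 hκ hdom
  have hl : 0 ≤ Real.log (1 / δ) := Real.log_nonneg (by rw [le_div_iff₀ hδ, one_mul]; exact hδ1.le)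
  have hn0 : (0 : ℝ) < n := by exact_mod_cast hn
  have hnσ : 0 < n * σ := mul_pos hn0 hσ
  have hnc : 0 ≤ Real.log (n * c) :=
    Real.log_nonneg (by exact_mod_cast Nat.mul_pos hn hc)
  have hBl := sq_mul_one_add_sqrt_le hB hBκ hl
  set s := √(Real.log (1 / δ))
  set C : ℝ := 3120 * L * √(2 * (κ + κ ^ 2)) + 8 * (520 * L) ^ 2 * (κ + κ ^ 2) + 1
  constructor
  · obtain ⟨G, hG, hGμ, hdev⟩ := P.exists_event_uniform (n := n) hn hc hδ hδ1.le
    refine HoldsWithProb.of_compl_le hG hδ.le hGμ fun S hS w => ?_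
    have hw := hdev S hS w
    change excessRisk ρ loss r wstar w ≤ _ + C * (1 + _ + Real.log (max 1 (n * σ *
      excessRisk ρ loss r wstar w))) ^ 4 * √(excessRisk ρ loss r wstar w * _ / _)
    set D := excessRisk ρ loss r wstar w
    have hD0 : 0 ≤ D := P.excessRisk_nonneg w
    set x := 1 + Real.log (n * c) + Real.log (max 1 (n * σ * D)) with hx
    have hx1 : 1 ≤ x := by
      have := Real.log_nonneg (le_max_left 1 (n * σ * D))
      linarith
    rcases le_or_gt D (1 / (n * σ)) with hle | hgt
    -- Below `1 / (n * σ)` the maximum in the statement already suffices, so peeling need not treat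
    -- small excess risks.
    · exact hle.trans ((le_max_right _ _).trans (le_add_of_nonneg_right (by positivity)))
    · have h1 := hw hgt
      have hy : 1 < n * σ * D := by rwa [div_lt_iff₀' hnσ] at hgt
      rw [max_eq_right hy.le] at hx
      rw [← hx] at h1
      have h2 : Btilde N * (1 + s) ≤ √(2 * (κ + κ ^ 2)) * √(Real.log (1 / δ) + Btilde N) := by
        rw [← Real.sqrt_mul (by positivity)]
        exact Real.le_sqrt_of_sq_le hBl
      have h3 : √(D * (Real.log (1 / δ) + Btilde N) / (n * σ))
          = √(Real.log (1 / δ) + Btilde N) * √(D / (n * σ)) := by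
        rw [← Real.sqrt_mul (by positivity)]; congr 1; ring
      have h4 : 3120 * L * x ^ 3 * (Btilde N * (1 + s)) * √(D / (n * σ))
          ≤ C * x ^ 4 * √(D * (Real.log (1 / δ) + Btilde N) / (n * σ)) := by
        rw [h3]
        calc 3120 * L * x ^ 3 * (Btilde N * (1 + s)) * √(D / (n * σ))
            ≤ 3120 * L * x ^ 4 * (√(2 * (κ + κ ^ 2)) * √(Real.log (1 / δ) + Btilde N))
                * √(D / (n * σ)) := by
              gcongr
              norm_num
          _ = 3120 * L * √(2 * (κ + κ ^ 2)) * x ^ 4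
                * (√(Real.log (1 / δ) + Btilde N) * √(D / (n * σ))) := by ring
          _ ≤ _ := by
              gcongr
              have : 0 ≤ 8 * (520 * L) ^ 2 * (κ + κ ^ 2) := by positivity
              linarith
      have h5 := le_max_left (empiricalRisk loss r S w - empiricalRisk loss r S wstar)
        (1 / (n * σ))
      linarith
  · obtain ⟨G, hG, hGμ, hdev⟩ := P.exists_event_minimizer_le (n := n) hn hc hδ hδ1.le
    refine HoldsWithProb.of_compl_le hG hδ.le hGμ fun S hS wS hwS => ?_
    have h1 := hdev S hS wS hwS
    change excessRisk ρ loss r wstar wS ≤ _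
    refine h1.trans ?_
    set x := 1 + Real.log (n * c)
    calc 4 * (520 * L * x ^ 2 * (Btilde N * (1 + s))) ^ 2 / (n * σ)
        = 4 * (520 * L) ^ 2 * x ^ 4 * (Btilde N * (1 + s)) ^ 2 / (n * σ) := by ring
      _ ≤ 4 * (520 * L) ^ 2 * x ^ 4 * (2 * (κ + κ ^ 2) * (Real.log (1 / δ) + Btilde N))
            / (n * σ) := by gcongr
      _ = 8 * (520 * L) ^ 2 * (κ + κ ^ 2) * x ^ 4 * ((Real.log (1 / δ) + Btilde N) / (n * σ)) := by
          ring
      _ ≤ _ := by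
          gcongr
          have : 0 ≤ 3120 * L * √(2 * (κ + κ ^ 2)) := by positivity
          linarith
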